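/- **Setting.** Let $G=(V,\mathcal E)$ be a finite simple graph and $E(x)=\sum_{i\in V}\Theta_i(x_i)+\sum_{ij\in\mathcal E}\Theta_{ij}(x_i,x_j)$, $x\in\{0,1\}^V$, a real-valued energy that is submodular: $\Theta_{ij}(0,0)+\Theta_{ij}(1,1)\le\Theta_{ij}(0,1)+\Theta_{ij}(1,0)$ for every edge. An energy is *canonical* if $\Theta_{ij}(0,0)=\Theta_{ij}(1,1)=0$ and $\theta^{01}_{ij}:=\Theta_{ij}(0,1)\ge0$, $\Theta_{ij}(1,0)\ge0$ for all edges, and for all $i$ the numbers $\theta_i^a:=\Theta_i(a)$ are nonnegative and at least one of $\theta_i^0,\theta_i^1$ is $0$. A canonical form of $E$ is a canonical energy on $G$ that differs from $E$ by an additive constant. **Messages.** Messages are vectors indexed by $\{0,1\}$, each normalized by subtracting its smaller entry. *Strict MP* updates all messages in parallel from the old ones: $m_{\Theta_i\to x_i}=\Theta_i$; $m_{x_i\to\Theta_{ij}}=m_{\Theta_i\to x_i}+\sum_{k\in N(i)\setminus\{j\}}m_{\Theta_{ki}\to x_i}$; $m_{\Theta_{ij}\to x_j}(x_j)=\min_{x_i}[\Theta_{ij}(x_i,x_j)+m_{x_i\to\Theta_{ij}}(x_i)]$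 (all up to normalization). A *max-product (MP) fixed point* is a fixed point of Strict MP. The beliefs are $b_i=\Theta_i+\sum_{k\in N(i)}m_{\Theta_{ki}\to x_i}$. An assignment $x$ is *decoded* from them if $x_i\in\arg\min b_i$ for all $i$ and ties are broken consistently: $x_i=x_j$ whenever $b_i$ and $b_j$ are both tied and $ij$ is an edge with $\Theta_{ij}(0,0)+\Theta_{ij}(1,1)<\Theta_{ij}(0,1)+\Theta_{ij}(1,0)$. (Giving label $0$ to all tied variables is one such choice.) The fixed point is *optimal* if every assignment decoded from it has minimum energy. **APMP** on a canonical energy. All messages start at $0$. Put $r_{ij}=\theta_{ij}^{01}-m_{x_i\to\Theta_{ij}}(1)+m_{x_i\to\Theta_{ij}}(0)$, $r_{si}=\theta_i^1-m_{\Theta_i\to x_i}(1)$, $r_{it}=\theta_i^0-m_{\Theta_i\to x_i}(0)$. An *augmenting path* is a path $v_1,\dots,v_n$ ($n\ge 1$) in $G$ without repeated vertices for which the bottleneck capacity $f=\min(r_{sv_1},r_{v_1v_2},\dots,r_{v_{n-1}v_n},r_{v_nt})$ is positive. *Phase 1*: as long as there is an augmenting path, a scheduler, which may depend on the history of the run,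 chooses one. Messages are passed along it forward and then backward, all others being held fixed. The forward pass starts with the damped message $\lambda m_{\Theta_{v_1}\to x_{v_1}}+(1-\lambda)\Theta_{v_1}$, where $\lambda=\frac{\theta_{v_1}^1-f-b}{\theta_{v_1}^1-b}$ and $b=m_{\Theta_{v_1}\to x_{v_1}}(1)$. The backward pass starts with the analogous message of $\Theta_{v_n}$, with $\theta_{v_n}^0$ and $b=m_{\Theta_{v_n}\to x_{v_n}}(0)$. All other messages on the chain are undamped. *Phase 2*: when there is no augmenting path, Strict MP is iterated from the current messages. **Theorem (Guaranteed Convergence and Optimality of the APMP Fixed Point).** Let $E$ be a submodular energy as above. 1. $E$ has a canonical form. For every canonical form $C$ of $E$: - (a) A scheduler that always chooses an augmenting path with the fewest edges exists, and with any such scheduler Phase 1 of APMP on $C$ ends after finitely many iterations. If all potentials of $C$ are rational, Phase 1 ends after finitely many iterations with every scheduler. - (b) With every scheduler for which Phase 1 ends, APMP reaches an MP fixed point of $C$ after finitely many iterations and stays there. This fixed point is optimal: an assignment can be decoded from it, and every assignment decoded from it minimizes $C$, and hence $E$. 2. In particular, $E$ itself has an optimal MP fixed point. -/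

import Mathlib

/-- A graph-structured energy over binary variables (`false` is the label `0`, `true` the label `1`)
on a simple graph: unary potentials `Θ_i` and, for each edge `ij`, a pairwise potential `Θ_ij`.
The latter is stored once for each of the two orientations of the edge: `pair (i, j) a b` is
`Θ_ij (a, b)`, and `pair (j, i) b a` is the same number. -/
structure PairwiseEnergy {V : Type*} (G : SimpleGraph V) where
  unary : V → Bool → ℝ
  pair : G.Dart → Bool → Bool → ℝ
  pair_symm : ∀ d a b, pair d.symm b a = pair d a b

/-- The state of message passing. `unary i` is the message `Θ_i → x_i`; for an oriented edge
`d = (i, j)`, `toFactor d` is the message `x_i → Θ_ij` and `toVar d` is the message `Θ_ij → x_j`. -/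
@[ext] structure Messages {V : Type*} (G : SimpleGraph V) where
  unary : V → Bool → ℝ
  toFactor : G.Dart → Bool → ℝ
  toVar : G.Dart → Bool → ℝ

/-- A chain subgraph: a path (no repeated vertex) of the graph, from `first` to `last`. -/
structure Chain {V : Type*} (G : SimpleGraph V) where
  first : V
  last : V
  walk : G.Walk first last
  isPath : walk.IsPath

/-- All messages equal to `0`. -/
noncomputable def zeroMessages {V : Type*} (G : SimpleGraph V) : Messages G where
  unary := fun _ _ => 0
  toFactor := fun _ _ => 0
  toVar := fun _ _ => 0

/-- Message normalization: subtract a constant so that the smaller entry becomes `0`. -/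
noncomputable def normalizeMsg (μ : Bool → ℝ) : Bool → ℝ :=
  fun a => μ a - min (μ false) (μ true)

namespace PairwiseEnergy

section Energy

variable {V : Type*} [Fintype V] [DecidableEq V] {G : SimpleGraph V} [DecidableRel G.Adj]

/-- The energy of an assignment. Every edge is the edge of exactly two darts, which contribute the
same value; hence the factor `1 / 2`. -/
noncomputable def energy (E : PairwiseEnergy G) (x : V → Bool) : ℝ :=
  ∑ i, E.unary i (x i) + (1 / 2) * ∑ d : G.Dart, E.pair d (x d.fst) (x d.snd)

/-- Submodularity of the pairwise potentials. -/
def IsSubmodular (E : PairwiseEnergy G) : Prop :=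
  ∀ d, E.pair d false false + E.pair d true true ≤ E.pair d false true + E.pair d true false

/-- The normal form: nonnegative pairwise potentials with zero diagonal, and nonnegative unary
potentials at least one of whose two entries is `0`. -/
def IsCanonical (E : PairwiseEnergy G) : Prop :=
  (∀ d, E.pair d false false = 0 ∧ E.pair d true true = 0 ∧
    0 ≤ E.pair d false true ∧ 0 ≤ E.pair d true false) ∧
  ∀ i, 0 ≤ E.unary i false ∧ 0 ≤ E.unary i true ∧ (E.unary i false = 0 ∨ E.unary i true = 0)

/-- `C` and `E` give every assignment the same energy, up to one additive constant. -/
def IsReparametrization (C E : PairwiseEnergy G) : Prop :=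
  ∃ c : ℝ, ∀ x, E.energy x = C.energy x + c

/-- `x` is a minimum-energy assignment. -/
def IsMinimizer (E : PairwiseEnergy G) (x : V → Bool) : Prop :=
  ∀ y, E.energy x ≤ E.energy y

/-- All potentials take rational values only. -/
def IsRational (E : PairwiseEnergy G) : Prop :=
  (∀ i a, ∃ q : ℚ, E.unary i a = (q : ℝ)) ∧ ∀ d a b, ∃ q : ℚ, E.pair d a b = (q : ℝ)

/-! ### Max-product (min-sum) message updates -/

/-- The undamped, normalized message `Θ_i → x_i`. -/
noncomputable def unaryUpdate (E : PairwiseEnergy G) (i : V) : Bool → ℝ :=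
  normalizeMsg (E.unary i)

/-- For `d = (i, j)`, the normalized message `x_i → Θ_ij`: the sum of all messages into `x_i`,
except the one from `Θ_ij`. -/
noncomputable def toFactorUpdate (_E : PairwiseEnergy G) (m : Messages G) (d : G.Dart) : Bool → ℝ :=
  normalizeMsg fun a =>
    m.unary d.fst a + ∑ e : G.Dart with e.snd = d.fst ∧ e ≠ d.symm, m.toVar e a

/-- For `d = (i, j)`, the normalized message `Θ_ij → x_j`:
`x_j ↦ min over x_i of Θ_ij (x_i, x_j) + (message x_i → Θ_ij) (x_i)`. -/
noncomputable def toVarUpdate (E : PairwiseEnergy G) (m : Messages G) (d : G.Dart) : Bool → ℝ :=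
  normalizeMsg fun b =>
    min (E.pair d false b + m.toFactor d false) (E.pair d true b + m.toFactor d true)

/-- One iteration of Strict MP: all messages are updated in parallel, from the old messages. -/
noncomputable def strictMP (E : PairwiseEnergy G) (m : Messages G) : Messages G where
  unary := E.unaryUpdate
  toFactor := E.toFactorUpdate m
  toVar := E.toVarUpdate m

/-- A max-product fixed point: a fixed point of Strict MP. -/
def IsMPFixedPoint (E : PairwiseEnergy G) (m : Messages G) : Prop :=
  E.strictMP m = m

/-- The belief at `x_i`. -/
noncomputable def belief (E : PairwiseEnergy G) (m : Messages G) (i : V) (a : Bool) : ℝ :=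
  E.unary i a + ∑ e : G.Dart with e.snd = i, m.toVar e a

/-- `x` is decoded from the beliefs: `x_i` minimizes the belief at `i`, and ties are broken
consistently, that is, two variables with tied beliefs get the same label if they are joined by an
edge whose potential satisfies the submodularity inequality strictly (in normal form: an edge whose
potential is not identically `0`). -/
def IsDecoding (E : PairwiseEnergy G) (m : Messages G) (x : V → Bool) : Prop :=
  (∀ i a, E.belief m i (x i) ≤ E.belief m i a) ∧
  ∀ d : G.Dart,
    E.belief m d.fst false = E.belief m d.fst true →
    E.belief m d.snd false = E.belief m d.snd true →
    E.pair d false false + E.pair d true true < E.pair d false true + E.pair d true false →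
    x d.fst = x d.snd

/-- A max-product fixed point whose beliefs decode to minimum-energy assignments. -/
def IsOptimalFixedPoint (E : PairwiseEnergy G) (m : Messages G) : Prop :=
  E.IsMPFixedPoint m ∧ (∃ x, E.IsDecoding m x) ∧ ∀ x, E.IsDecoding m x → E.IsMinimizer x

/-! ### Residual capacities and augmenting paths -/

/-- `r_ij = θ_ij^01 - m_{x_i → Θ_ij}(1) + m_{x_i → Θ_ij}(0)` for `d = (i, j)`. -/
noncomputable def residual (E : PairwiseEnergy G) (m : Messages G) (d : G.Dart) : ℝ :=
  E.pair d false true - m.toFactor d true + m.toFactor d false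

/-- `r_si = θ_i^1 - m_{Θ_i → x_i}(1)`. -/
noncomputable def residualSource (E : PairwiseEnergy G) (m : Messages G) (i : V) : ℝ :=
  E.unary i true - m.unary i true

/-- `r_it = θ_i^0 - m_{Θ_i → x_i}(0)`. -/
noncomputable def residualSink (E : PairwiseEnergy G) (m : Messages G) (i : V) : ℝ :=
  E.unary i false - m.unary i false

/-- The bottleneck capacity: the smallest residual capacity of an edge on the path
`s, first, …, last, t`. -/
noncomputable def bottleneck (E : PairwiseEnergy G) (m : Messages G) (T : Chain G) : ℝ :=
  (T.walk.darts.map (E.residual m)).foldr min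
    (min (E.residualSink m T.last) (E.residualSource m T.first))

/-- The path `s, first, …, last, t` has positive capacity. -/
def IsAugmenting (E : PairwiseEnergy G) (m : Messages G) (T : Chain G) : Prop :=
  0 < E.bottleneck m T

/-! ### Phase 1: message passing on one chain -/

/-- Send the message `Θ_i → x_i`, damped with parameter `l`. -/
noncomputable def sendUnary (E : PairwiseEnergy G) (l : ℝ) (m : Messages G) (i : V) : Messages G :=
  { m with
    unary := Function.update m.unary i
      (normalizeMsg fun a => l * m.unary i a + (1 - l) * E.unary i a) }

/-- For `d = (i, j)`, send (undamped) the message `x_i → Θ_ij` and then the message `Θ_ij → x_j`. -/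
noncomputable def sendDart (E : PairwiseEnergy G) (m : Messages G) (d : G.Dart) : Messages G :=
  let m' : Messages G := { m with toFactor := Function.update m.toFactor d (E.toFactorUpdate m d) }
  { m' with toVar := Function.update m'.toVar d (E.toVarUpdate m' d) }

/-- The damping parameter of the first unary factor: it turns the entry `b` of the old message into
`b + f`, where `f` is the bottleneck capacity. -/
noncomputable def dampingFirst (E : PairwiseEnergy G) (m : Messages G) (T : Chain G) : ℝ :=
  (E.unary T.first true - E.bottleneck m T - m.unary T.first true) /
    (E.unary T.first true - m.unary T.first true)

/-- The damping parameter of the last unary factor. -/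
noncomputable def dampingLast (E : PairwiseEnergy G) (m : Messages G) (T : Chain G) : ℝ :=
  (E.unary T.last false - E.bottleneck m T - m.unary T.last false) /
    (E.unary T.last false - m.unary T.last false)

/-- One iteration of Phase 1 on the chain `T`: messages are passed forward and then backward along
`T`, starting with the damped message of the unary factor at the end in question; all other
messages are held fixed. -/
noncomputable def passChain (E : PairwiseEnergy G) (m : Messages G) (T : Chain G) : Messages G :=
  let m₁ := E.sendUnary (E.dampingFirst m T) m T.first
  let m₂ := T.walk.darts.foldl E.sendDart m₁
  let m₃ := E.sendUnary (E.dampingLast m T) m₂ T.last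
  T.walk.reverse.darts.foldl E.sendDart m₃

/-! ### The algorithm -/

/-- A scheduler returns an augmenting path for the current messages if there is one, and `none` if
there is none. It may depend on the iteration (and so on the history of the run). -/
def IsScheduler (E : PairwiseEnergy G) (S : ℕ → Messages G → Option (Chain G)) : Prop :=
  ∀ t m, (∀ T, S t m = some T → E.IsAugmenting m T) ∧
    (S t m = none → ∀ T, ¬ E.IsAugmenting m T)

/-- The scheduler only returns augmenting paths with the fewest possible edges. -/
def IsShortestPath (E : PairwiseEnergy G) (S : ℕ → Messages G → Option (Chain G)) : Prop :=
  ∀ t m T, S t m = some T → ∀ T', E.IsAugmenting m T' → T.walk.length ≤ T'.walk.length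

/-- Augmenting Paths Max-Product, from zero messages. The state after `t` iterations consists of the
messages and a flag that tells whether Phase 2 has been entered. In Phase 1 messages are passed on
the chain which the scheduler returns; when it returns none, Phase 2 (Strict MP) begins. -/
noncomputable def apmp (E : PairwiseEnergy G) (S : ℕ → Messages G → Option (Chain G)) :
    ℕ → Messages G × Bool
  | 0 => (zeroMessages G, false)
  | t + 1 =>
    match apmp E S t with
    | (m, true) => (E.strictMP m, true)
    | (m, false) =>
      match S t m with
      | some T => (E.passChain m T, false)
      | none => (m, true)

/-- Phase 1 ends after finitely many iterations. -/
def Phase1Terminates (E : PairwiseEnergy G) (S : ℕ → Messages G → Option (Chain G)) : Prop :=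
  ∃ t, (E.apmp S t).2 = true

end Energy

end PairwiseEnergy

/-! A normalized binary message is determined by the difference of its two entries. During Phase 1
these differences form an `s`-`t` flow in the network whose capacities are the canonical potentials,
and passing messages along an augmenting path is one Ford–Fulkerson augmentation. Shortest
augmenting paths terminate by the argument of Edmonds and Karp, rational potentials because all
bottlenecks are multiples of a common unit.

Without augmenting paths, the vertices split into those reached from the source in the residual
network, those reaching the sink, and the rest. Strict MP then moves the differences monotonically,
with opposite signs on the two sides, and the magnitudes of the moves lie in a finitely generated
submonoid of `[0, ∞)` and are bounded by residual capacities, so they become stationary. The final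
beliefs strictly prefer the label of the terminal on each side and are tied elsewhere, so
every decoding cuts only saturated edges and is a minimum cut.

For an arbitrary submodular energy, moving the unary parts of the pairwise potentials into the unary
potentials shifts each message difference by a constant. This carries the fixed points and decodings
of the canonical form over to the original energy. -/

/-- The normalized message whose entries differ by `z`; normalized messages are thus parametrized by
real numbers. -/
noncomputable def msgOfDiff (z : ℝ) : Bool → ℝ
  | true => z⁺
  | false => z⁻

theorem msgOfDiff_sub (z : ℝ) : msgOfDiff z true - msgOfDiff z false = z :=
  posPart_sub_negPart z

theorem normalizeMsg_eq_msgOfDiff (μ : Bool → ℝ) :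
    normalizeMsg μ = msgOfDiff (μ true - μ false) := by
  funext a
  rcases le_total (μ false) (μ true) with h | h <;> cases a <;>
    simp [normalizeMsg, msgOfDiff, h]

theorem normalizeMsg_eq_self {μ : Bool → ℝ} (h : min (μ false) (μ true) = 0) :
    normalizeMsg μ = μ := by
  funext a
  rw [normalizeMsg, h, sub_zero]

theorem min_normalizeMsg (μ : Bool → ℝ) : min (normalizeMsg μ false) (normalizeMsg μ true) = 0 := by
  rw [normalizeMsg, normalizeMsg, min_sub_sub_right, sub_self]

theorem sum_dart_snd_eq_add {V M : Type*} [Fintype V] [DecidableEq V] {G : SimpleGraph V}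
    [DecidableRel G.Adj] [AddCommMonoid M] (g : G.Dart → M) (d : G.Dart) :
    ∑ e : G.Dart with e.snd = d.fst, g e =
      g d.symm + ∑ e : G.Dart with e.snd = d.fst ∧ e ≠ d.symm, g e := by
  have hd : d.symm ∈ ({e : G.Dart | e.snd = d.fst} : Finset G.Dart) := by simp
  rw [← Finset.add_sum_erase _ _ hd, ← Finset.filter_ne', Finset.filter_filter]

namespace Messages

section Flow

variable {V : Type*} {G : SimpleGraph V}

/-- The difference of the two entries of the message `Θ_ij → x_j`, for `d = (i, j)`. -/
noncomputable def flow (m : Messages G) (d : G.Dart) : ℝ := m.toVar d true - m.toVar d false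

end Flow

variable {V : Type*} [Fintype V] [DecidableEq V] {G : SimpleGraph V} [DecidableRel G.Adj]

/-- The difference of the two entries of the sum of all messages into `x_i`. -/
noncomputable def excess (m : Messages G) (i : V) : ℝ :=
  m.unary i true - m.unary i false + ∑ e : G.Dart with e.snd = i, m.flow e

end Messages

theorem symm_notMem_darts_of_isTrail {V : Type*} {G : SimpleGraph V} {u v : V} {p : G.Walk u v}
    (hp : p.IsTrail) {d : G.Dart} (hd : d ∈ p.darts) : d.symm ∉ p.darts := fun hd' =>
  d.symm_ne (List.inj_on_of_nodup_map hp.edges_nodup hd' hd d.edge_symm)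

theorem sum_ite_mem_darts_of_isPath {V M : Type*} [Fintype V] [DecidableEq V] {G : SimpleGraph V}
    [DecidableRel G.Adj] [AddCommMonoid M] {u v : V} {p : G.Walk u v} (hp : p.IsPath) (a : M)
    (x : V) :
    ∑ e : G.Dart with e.snd = x, (if e ∈ p.darts then a else 0) =
      if x ∈ p.support ∧ x ≠ u then a else 0 := by
  induction p with
  | nil => simp
  | @cons u v w huv p ih =>
    rw [SimpleGraph.Walk.cons_isPath_iff] at hp
    obtain ⟨hp, hu⟩ := hp
    have hnotMem : (⟨(u, v), huv⟩ : G.Dart) ∉ p.darts := fun h =>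
      hu (p.dart_fst_mem_support_of_mem_darts h)
    have hsplit (e : G.Dart) : (if e ∈ (SimpleGraph.Walk.cons huv p).darts then a else 0) =
        (if e = ⟨(u, v), huv⟩ then a else 0) + if e ∈ p.darts then a else 0 := by
      by_cases he : e = ⟨(u, v), huv⟩ <;> simp [he, hnotMem]
    simp_rw [hsplit]
    rw [Finset.sum_add_distrib, ih hp, Finset.sum_ite_eq']
    have hv : v ∈ p.support := p.start_mem_support
    rcases eq_or_ne x v with rfl | hxv
    · simp [huv.ne']
    · rcases eq_or_ne x u with rfl | hxu
      · simp [hu, hxv.symm]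
      · simp [hxv, hxu, hxv.symm]

namespace Messages

variable {V : Type*} [DecidableEq V] {G : SimpleGraph V}

/-- The messages obtained by adding `δ` to the flow along every dart of `l`; both messages of such a
dart become the normalized message with the new difference. -/
@[simps]
noncomputable def push (m : Messages G) (l : List G.Dart) (δ : ℝ) : Messages G where
  unary := m.unary
  toFactor d := if d ∈ l then msgOfDiff (m.flow d + δ) else m.toFactor d
  toVar d := if d ∈ l then msgOfDiff (m.flow d + δ) else m.toVar d

theorem flow_push (m : Messages G) (l : List G.Dart) (δ : ℝ) (d : G.Dart) :
    (m.push l δ).flow d = m.flow d + if d ∈ l then δ else 0 := by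
  by_cases hd : d ∈ l <;> simp [flow, push, hd, msgOfDiff_sub]

theorem push_nil (m : Messages G) (δ : ℝ) : m.push [] δ = m := by
  simp [push]

theorem push_push_singleton (m : Messages G) {d : G.Dart} {l : List G.Dart} (hd : d ∉ l) (δ : ℝ) :
    (m.push [d] δ).push l δ = m.push (d :: l) δ := by
  have hflow {e : G.Dart} (he : e ∈ l) : (m.push [d] δ).flow e = m.flow e := by
    have : e ≠ d := fun h => hd (h ▸ he)
    simp [flow_push, this]
  ext e a
  · rfl
  all_goals
    by_cases he : e ∈ l
    · simp [he, hflow he]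
    · simp [he]

theorem excess_push [Fintype V] [DecidableRel G.Adj] (m : Messages G) (l : List G.Dart) (δ : ℝ)
    (i : V) :
    (m.push l δ).excess i = m.excess i + ∑ e : G.Dart with e.snd = i, if e ∈ l then δ else 0 := by
  simp only [excess, flow_push, Finset.sum_add_distrib, push_unary, add_assoc]

end Messages

namespace PairwiseEnergy

theorem pair_true_false {V : Type*} {G : SimpleGraph V} (E : PairwiseEnergy G) (d : G.Dart) :
    E.pair d true false = E.pair d.symm false true := (E.pair_symm d true false).symm

theorem toVarUpdate_eq {V : Type*} {G : SimpleGraph V} {C : PairwiseEnergy G}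
    (hC : C.IsCanonical) {m : Messages G} {d : G.Dart} {z : ℝ} (h : m.toFactor d = msgOfDiff z) :
    C.toVarUpdate m d =
      msgOfDiff (max (-C.pair d.symm false true) (min z (C.pair d false true))) := by
  obtain ⟨h00, h11, h01, h10⟩ := hC.1 d
  rw [toVarUpdate, normalizeMsg_eq_msgOfDiff, h, h00, h11, pair_true_false] at *
  congr 1
  simp only [msgOfDiff]
  rcases le_total 0 z with hz | hz
  · grind [posPart_eq_self, negPart_eq_zero]
  · grind [negPart_eq_neg, posPart_eq_zero]

variable {V : Type*} [Fintype V] [DecidableEq V] {G : SimpleGraph V} [DecidableRel G.Adj]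

theorem toFactorUpdate_eq (E : PairwiseEnergy G) (m : Messages G) (d : G.Dart) :
    E.toFactorUpdate m d = msgOfDiff (m.excess d.fst - m.flow d.symm) := by
  rw [toFactorUpdate, normalizeMsg_eq_msgOfDiff, Messages.excess, sum_dart_snd_eq_add m.flow d]
  simp only [Messages.flow, Finset.sum_sub_distrib]
  congr 1
  ring

end PairwiseEnergy

/-! ### Augmentation by message passing -/

namespace PairwiseEnergy

variable {V : Type*} [Fintype V] [DecidableEq V] {G : SimpleGraph V} [DecidableRel G.Adj]

theorem sendDart_eq_push {C : PairwiseEnergy G} (hC : C.IsCanonical) {m : Messages G} {d : G.Dart}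
    {δ : ℝ} (hd : m.excess d.fst = m.flow d + m.flow d.symm + δ)
    (hcap : m.flow d + δ ∈ Set.Icc (-C.pair d.symm false true) (C.pair d false true)) :
    C.sendDart m d = m.push [d] δ := by
  have hfactor : C.toFactorUpdate m d = msgOfDiff (m.flow d + δ) := by
    rw [toFactorUpdate_eq, hd]
    congr 1
    ring
  have hvar := C.toVarUpdate_eq hC
    (m := { m with toFactor := Function.update m.toFactor d (msgOfDiff (m.flow d + δ)) })
    (Function.update_self ..)
  rw [min_eq_left hcap.2, max_eq_right hcap.1] at hvar
  rw [sendDart, hfactor, hvar]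
  ext e a
  · rfl
  all_goals by_cases he : e = d <;> simp [he]

/-- Each vertex of the path passes the surplus `δ` of its excess over `h` on to the next one. -/
theorem foldl_sendDart_eq_push {C : PairwiseEnergy G} (hC : C.IsCanonical) {h δ : ℝ} {u w : V}
    {p : G.Walk u w} (hp : p.IsPath) {m : Messages G} (hu : m.excess u = h + δ)
    (hexcess : ∀ x ∈ p.support, x ≠ u → m.excess x = h)
    (hflow : ∀ d ∈ p.darts, m.flow d + m.flow d.symm = h)
    (hcap : ∀ d ∈ p.darts,
      m.flow d + δ ∈ Set.Icc (-C.pair d.symm false true) (C.pair d false true)) :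
    p.darts.foldl C.sendDart m = m.push p.darts δ := by
  induction p generalizing m with
  | nil => exact (m.push_nil δ).symm
  | @cons u v w huv p ih =>
    rw [SimpleGraph.Walk.cons_isPath_iff] at hp
    obtain ⟨hp, hup⟩ := hp
    simp only [SimpleGraph.Walk.darts_cons, List.mem_cons, forall_eq_or_imp,
      SimpleGraph.Walk.support_cons] at hexcess hflow hcap ⊢
    set d₀ : G.Dart := ⟨(u, v), huv⟩
    have hd₀ : d₀ ∉ p.darts := fun hd => hup (p.dart_fst_mem_support_of_mem_darts hd)
    have hd₀_symm : ∀ d ∈ p.darts, d.symm ≠ d₀ := fun d hd hd' => by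
      have hsnd : d.snd = u := congrArg (·.fst) hd'
      exact hup (hsnd ▸ p.dart_snd_mem_support_of_mem_darts hd)
    have hexcess' (x : V) :
        (m.push [d₀] δ).excess x = m.excess x + if x = v then δ else 0 := by
      rw [Messages.excess_push]
      simp [Finset.sum_ite_eq', d₀, eq_comm]
    have hflow' : ∀ d ∈ p.darts, (m.push [d₀] δ).flow d = m.flow d ∧
        (m.push [d₀] δ).flow d.symm = m.flow d.symm := fun d hd => by
      simp [Messages.flow_push, hd₀_symm d hd, ne_of_mem_of_not_mem hd hd₀]
    rw [List.foldl_cons, sendDart_eq_push hC (by rw [hflow.1]; exact hu) hcap.1,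
      ih hp, Messages.push_push_singleton _ hd₀]
    · rw [hexcess', if_pos rfl, hexcess.2 v p.start_mem_support huv.ne']
    · intro x hx hxv
      rw [hexcess', if_neg hxv, add_zero]
      exact hexcess.2 x hx fun hxu => hup (hxu ▸ hx)
    · intro d hd
      rw [(hflow' d hd).1, (hflow' d hd).2, hflow.2 d hd]
    · intro d hd
      rw [(hflow' d hd).1]
      exact hcap.2 d hd

end PairwiseEnergy

theorem le_foldr_min_iff {α : Type*} [LinearOrder α] {a b : α} {l : List α} :
    a ≤ l.foldr min b ↔ a ≤ b ∧ ∀ x ∈ l, a ≤ x := by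
  induction l with
  | nil => simp
  | cons x l ih => simp [ih, and_left_comm]

theorem foldr_min_mem {α : Type*} [LinearOrder α] (b : α) (l : List α) :
    l.foldr min b ∈ b :: l := by
  induction l with
  | nil => simp
  | cons x l ih =>
    rw [List.foldr_cons]
    rcases min_choice x (l.foldr min b) with h | h <;> grind

namespace PairwiseEnergy

section Bottleneck

variable {V : Type*} {G : SimpleGraph V} (E : PairwiseEnergy G) (m : Messages G) (T : Chain G)

theorem le_bottleneck_iff {a : ℝ} :
    a ≤ E.bottleneck m T ↔ a ≤ E.residualSource m T.first ∧ a ≤ E.residualSink m T.last ∧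
      ∀ d ∈ T.walk.darts, a ≤ E.residual m d := by
  simp only [bottleneck, le_foldr_min_iff, le_min_iff, List.forall_mem_map]
  tauto

theorem bottleneck_eq_residual :
    E.bottleneck m T = E.residualSource m T.first ∨ E.bottleneck m T = E.residualSink m T.last ∨
      ∃ d ∈ T.walk.darts, E.bottleneck m T = E.residual m d := by
  have hmem := foldr_min_mem (min (E.residualSink m T.last) (E.residualSource m T.first))
    (T.walk.darts.map (E.residual m))
  rw [← bottleneck, List.mem_cons, List.mem_map] at hmem
  rcases hmem with h | ⟨d, hd, h⟩
  · rcases min_choice (E.residualSink m T.last) (E.residualSource m T.first) with h' | h'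
    · exact .inr (.inl (h.trans h'))
    · exact .inl (h.trans h')
  · exact .inr (.inr ⟨d, hd, h.symm⟩)

theorem isAugmenting_iff :
    E.IsAugmenting m T ↔ 0 < E.residualSource m T.first ∧ 0 < E.residualSink m T.last ∧
      ∀ d ∈ T.walk.darts, 0 < E.residual m d := by
  obtain ⟨hs, ht, hr⟩ := (E.le_bottleneck_iff m T).1 le_rfl
  refine ⟨fun h => ⟨h.trans_le hs, h.trans_le ht, fun d hd => h.trans_le (hr d hd)⟩, ?_⟩
  rintro ⟨hs, ht, hr⟩
  rcases E.bottleneck_eq_residual m T with h | h | ⟨d, hd, h⟩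
  · exact hs.trans_eq h.symm
  · exact ht.trans_eq h.symm
  · exact (hr d hd).trans_eq h.symm

end Bottleneck

end PairwiseEnergy

namespace Messages

variable {V : Type*} [DecidableEq V] {G : SimpleGraph V}

/-- The messages in which the entry `a` of the unary message `Θ_j → x_j` is increased by `f`. -/
@[simps]
noncomputable def raiseUnary (m : Messages G) (j : V) (a : Bool) (f : ℝ) : Messages G where
  unary i b := m.unary i b + if i = j ∧ b = a then f else 0
  toFactor := m.toFactor
  toVar := m.toVar

theorem flow_raiseUnary (m : Messages G) (j : V) (a : Bool) (f : ℝ) (d : G.Dart) :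
    (m.raiseUnary j a f).flow d = m.flow d := rfl

/-- The messages after `f` units of flow have been sent from the source along `T` to the sink. They
are written as the four stages of an iteration of Phase 1: raise the first unary message, push
forward, raise the last unary message, push backward. -/
noncomputable def augment (m : Messages G) (T : Chain G) (f : ℝ) : Messages G :=
  (((m.raiseUnary T.first true f).push T.walk.darts f).raiseUnary T.last false f).push
    T.walk.reverse.darts (-f)

theorem unary_augment (m : Messages G) (T : Chain G) (f : ℝ) (i : V) (a : Bool) :
    (m.augment T f).unary i a = m.unary i a + (if i = T.first ∧ a = true then f else 0) +
      if i = T.last ∧ a = false then f else 0 := rfl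

theorem flow_augment (m : Messages G) (T : Chain G) (f : ℝ) (d : G.Dart) :
    (m.augment T f).flow d = m.flow d + (if d ∈ T.walk.darts then f else 0) -
      if d.symm ∈ T.walk.darts then f else 0 := by
  simp only [augment, flow_push, flow_raiseUnary, SimpleGraph.Walk.mem_darts_reverse,
    sub_eq_add_neg, neg_ite, neg_zero]

theorem toFactor_push_eq {m : Messages G} {d : G.Dart} (h : m.toFactor d = msgOfDiff (m.flow d))
    (l : List G.Dart) (δ : ℝ) :
    (m.push l δ).toFactor d = msgOfDiff ((m.push l δ).flow d) := by
  funext a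
  by_cases hd : d ∈ l <;> simp [flow_push, hd, h]

theorem toVar_push_eq {m : Messages G} {d : G.Dart} (h : m.toVar d = msgOfDiff (m.flow d))
    (l : List G.Dart) (δ : ℝ) :
    (m.push l δ).toVar d = msgOfDiff ((m.push l δ).flow d) := by
  funext a
  by_cases hd : d ∈ l <;> simp [flow_push, hd, h]

variable [Fintype V] [DecidableRel G.Adj]

theorem excess_raiseUnary (m : Messages G) (j : V) (a : Bool) (f : ℝ) (i : V) :
    (m.raiseUnary j a f).excess i =
      m.excess i + if i = j then (if a = true then f else -f) else 0 := by
  simp only [excess, flow_raiseUnary, raiseUnary_unary]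
  by_cases hi : i = j <;> cases a <;> simp [hi] <;> ring

theorem excess_augment (m : Messages G) (T : Chain G) (f : ℝ) (i : V) :
    (m.augment T f).excess i = m.excess i := by
  rw [augment, excess_push, excess_raiseUnary, excess_push, excess_raiseUnary,
    sum_ite_mem_darts_of_isPath T.isPath, sum_ite_mem_darts_of_isPath T.isPath.reverse]
  have hfirst := T.walk.start_mem_support
  have hlast := T.walk.end_mem_support
  simp only [SimpleGraph.Walk.support_reverse, List.mem_reverse, if_true, Bool.false_eq_true,
    if_false]
  grind

end Messages

namespace PairwiseEnergy

variable {V : Type*} [Fintype V] [DecidableEq V] {G : SimpleGraph V} [DecidableRel G.Adj]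

/-- The messages `m` encode a flow in the network with capacities `C.pair d false true` on the
darts, `C.unary i true` from the source to `i`, and `C.unary i false` from `i` to the sink: it sends
`m.flow d` along `d`, `m.unary i true` from the source to `i`, and `m.unary i false` from `i` to the
sink. -/
structure IsFlow (C : PairwiseEnergy G) (m : Messages G) : Prop where
  flow_symm : ∀ d, m.flow d.symm = -m.flow d
  flow_le : ∀ d, m.flow d ≤ C.pair d false true
  toFactor_eq : ∀ d, m.toFactor d = msgOfDiff (m.flow d)
  toVar_eq : ∀ d, m.toVar d = msgOfDiff (m.flow d)
  unary_nonneg : ∀ i a, 0 ≤ m.unary i a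
  unary_le : ∀ i a, m.unary i a ≤ C.unary i a
  excess_eq : ∀ i, m.excess i = 0

theorem isFlow_zeroMessages {C : PairwiseEnergy G} (hC : C.IsCanonical) :
    C.IsFlow (zeroMessages G) where
  flow_symm d := by simp [Messages.flow, zeroMessages]
  flow_le d := by simpa [Messages.flow, zeroMessages] using (hC.1 d).2.2.1
  toFactor_eq d := by funext a; cases a <;> simp [Messages.flow, zeroMessages, msgOfDiff]
  toVar_eq d := by funext a; cases a <;> simp [Messages.flow, zeroMessages, msgOfDiff]
  unary_nonneg _ _ := le_rfl
  unary_le i a := by cases a; exacts [(hC.2 i).1, (hC.2 i).2.1]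
  excess_eq i := by simp [Messages.excess, Messages.flow, zeroMessages]

namespace IsFlow

variable {C : PairwiseEnergy G} {m : Messages G} {T : Chain G} {f : ℝ}

theorem residual_eq (h : C.IsFlow m) (d : G.Dart) :
    C.residual m d = C.pair d false true - m.flow d := by
  rw [residual, h.toFactor_eq]
  linarith [msgOfDiff_sub (m.flow d)]

theorem residual_nonneg (h : C.IsFlow m) (d : G.Dart) : 0 ≤ C.residual m d := by
  linarith [h.residual_eq d, h.flow_le d]

theorem neg_pair_le_flow (h : C.IsFlow m) (d : G.Dart) : -C.pair d.symm false true ≤ m.flow d := by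
  linarith [h.flow_le d.symm, h.flow_symm d]

theorem augment (h : C.IsFlow m) (hf : 0 ≤ f) (hfT : f ≤ C.bottleneck m T) :
    C.IsFlow (m.augment T f) := by
  obtain ⟨hs, ht, hr⟩ := (C.le_bottleneck_iff m T).1 hfT
  rw [residualSource] at hs
  rw [residualSink] at ht
  refine ⟨fun d => ?_, fun d => ?_, fun d => ?_, fun d => ?_, fun i a => ?_, fun i a => ?_,
    fun i => ?_⟩
  · simp only [Messages.flow_augment, h.flow_symm, SimpleGraph.Dart.symm_symm]
    ring
  · have hle := h.flow_le d
    have hres := h.residual_eq d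
    rw [Messages.flow_augment]
    by_cases hd : d ∈ T.walk.darts
    · have := hr d hd
      split_ifs <;> linarith
    · split_ifs <;> linarith
  · exact Messages.toFactor_push_eq (Messages.toFactor_push_eq (h.toFactor_eq d) _ _) _ _
  · exact Messages.toVar_push_eq (Messages.toVar_push_eq (h.toVar_eq d) _ _) _ _
  · have := h.unary_nonneg i a
    rw [Messages.unary_augment]
    split_ifs <;> linarith
  · have := h.unary_le i a
    rw [Messages.unary_augment]
    cases a <;> grind
  · rw [Messages.excess_augment, h.excess_eq]

theorem residual_augment (h : C.IsFlow m) (hf : 0 ≤ f) (hfT : f ≤ C.bottleneck m T) (d : G.Dart) :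
    C.residual (m.augment T f) d = C.residual m d - (if d ∈ T.walk.darts then f else 0) +
      if d.symm ∈ T.walk.darts then f else 0 := by
  rw [(h.augment hf hfT).residual_eq, h.residual_eq, Messages.flow_augment]
  ring

end IsFlow

theorem residualSource_augment {V : Type*} [DecidableEq V] {G : SimpleGraph V}
    (C : PairwiseEnergy G) (m : Messages G) (T : Chain G) (f : ℝ) (i : V) :
    C.residualSource (m.augment T f) i =
      C.residualSource m i - if i = T.first then f else 0 := by
  simp [residualSource, Messages.unary_augment, sub_sub]

theorem residualSink_augment {V : Type*} [DecidableEq V] {G : SimpleGraph V}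
    (C : PairwiseEnergy G) (m : Messages G) (T : Chain G) (f : ℝ) (i : V) :
    C.residualSink (m.augment T f) i =
      C.residualSink m i - if i = T.last then f else 0 := by
  simp [residualSink, Messages.unary_augment, sub_sub]

namespace IsFlow

variable {C : PairwiseEnergy G} {m : Messages G} {T : Chain G} {f : ℝ}

theorem unary_first_eq_zero (hC : C.IsCanonical) (h : C.IsFlow m) (hT : C.IsAugmenting m T) :
    C.unary T.first false = 0 := by
  have hs := ((C.isAugmenting_iff m T).1 hT).1
  have := h.unary_nonneg T.first true
  rw [residualSource] at hs
  exact (hC.2 T.first).2.2.resolve_right (by linarith)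

theorem unary_last_eq_zero (hC : C.IsCanonical) (h : C.IsFlow m) (hT : C.IsAugmenting m T) :
    C.unary T.last true = 0 := by
  have ht := ((C.isAugmenting_iff m T).1 hT).2.1
  have := h.unary_nonneg T.last false
  rw [residualSink] at ht
  exact (hC.2 T.last).2.2.resolve_left (by linarith)

theorem unary_eq_zero (h : C.IsFlow m) {i : V} {a : Bool} (hia : C.unary i a = 0) :
    m.unary i a = 0 :=
  le_antisymm (hia ▸ h.unary_le i a) (h.unary_nonneg i a)

theorem first_ne_last (hC : C.IsCanonical) (h : C.IsFlow m) (hT : C.IsAugmenting m T) :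
    T.first ≠ T.last := fun heq => by
  have ht := ((C.isAugmenting_iff m T).1 hT).2.1
  have hlast : C.unary T.last false = 0 := heq ▸ h.unary_first_eq_zero hC hT
  rw [residualSink, hlast, h.unary_eq_zero hlast, sub_self] at ht
  exact ht.false

theorem foldl_sendDart_forward (hC : C.IsCanonical) (h : C.IsFlow m) (hf : 0 ≤ f)
    (hfT : f ≤ C.bottleneck m T) :
    T.walk.darts.foldl C.sendDart (m.raiseUnary T.first true f) =
      (m.raiseUnary T.first true f).push T.walk.darts f := by
  have hr := ((C.le_bottleneck_iff m T).1 hfT).2.2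
  refine foldl_sendDart_eq_push hC (h := 0) T.isPath ?_ (fun x _ hx => ?_) (fun d _ => ?_)
    fun d hd => ?_
  · simp [Messages.excess_raiseUnary, h.excess_eq]
  · simp [Messages.excess_raiseUnary, h.excess_eq, hx]
  · simp [Messages.flow_raiseUnary, h.flow_symm]
  · have := hr d hd
    rw [h.residual_eq] at this
    rw [Messages.flow_raiseUnary]
    constructor <;> linarith [h.neg_pair_le_flow d]

theorem foldl_sendDart_backward (hC : C.IsCanonical) (h : C.IsFlow m) (hf : 0 ≤ f)
    (hfT : f ≤ C.bottleneck m T) :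
    T.walk.reverse.darts.foldl C.sendDart
        (((m.raiseUnary T.first true f).push T.walk.darts f).raiseUnary T.last false f) =
      m.augment T f := by
  have hr := ((C.le_bottleneck_iff m T).1 hfT).2.2
  have hexcess : ∀ x ∈ T.walk.support,
      (((m.raiseUnary T.first true f).push T.walk.darts f).raiseUnary T.last false f).excess x =
        f + if x = T.last then -f else 0 := fun x hx => by
    rw [Messages.excess_raiseUnary, Messages.excess_push, Messages.excess_raiseUnary,
      sum_ite_mem_darts_of_isPath T.isPath, h.excess_eq]
    by_cases hx' : x = T.first <;> simp [hx, hx']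
  refine foldl_sendDart_eq_push hC (h := f) T.isPath.reverse ?_ (fun x hx hxl => ?_)
    (fun d hd => ?_) fun d hd => ?_
  · simp [hexcess T.last T.walk.end_mem_support]
  · rw [SimpleGraph.Walk.support_reverse, List.mem_reverse] at hx
    simp [hexcess x hx, hxl]
  all_goals
    have hsymm := SimpleGraph.Walk.mem_darts_reverse.1 hd
    have hnotMem : d ∉ T.walk.darts :=
      d.symm_symm ▸ symm_notMem_darts_of_isTrail T.isPath.isTrail hsymm
    simp only [Messages.flow_raiseUnary, Messages.flow_push, hsymm, hnotMem, if_true, if_false,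
      h.flow_symm, add_zero]
  · ring
  · have := hr _ hsymm
    rw [h.residual_eq, h.flow_symm] at this
    constructor <;> linarith [h.flow_le d]

end IsFlow

theorem sendUnary_eq_raiseUnary {V : Type*} [DecidableEq V] {G : SimpleGraph V}
    {E : PairwiseEnergy G} {m : Messages G} {i : V} {a : Bool} {f : ℝ}
    (hE : E.unary i (!a) = 0) (hm : m.unary i (!a) = 0) (hnonneg : 0 ≤ m.unary i a)
    (hlt : m.unary i a < E.unary i a) (hf : 0 ≤ f) :
    E.sendUnary ((E.unary i a - f - m.unary i a) / (E.unary i a - m.unary i a)) m i =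
      m.raiseUnary i a f := by
  set l := (E.unary i a - f - m.unary i a) / (E.unary i a - m.unary i a) with hl
  have hdamped : l * m.unary i a + (1 - l) * E.unary i a = m.unary i a + f := by
    have : E.unary i a - m.unary i a ≠ 0 := by linarith
    rw [hl]
    field_simp
    ring
  have hmsg : (fun b => l * m.unary i b + (1 - l) * E.unary i b) =
      fun b => m.unary i b + if b = a then f else 0 := by
    funext b
    rcases Bool.eq_or_eq_not b a with rfl | rfl
    · simpa using hdamped
    · simp [hE, hm]
  have hmin : min (m.unary i false + if false = a then f else 0)
      (m.unary i true + if true = a then f else 0) = 0 := by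
    cases a <;> simp_all [add_nonneg]
  rw [sendUnary, hmsg, normalizeMsg_eq_self hmin]
  ext j b
  · rcases eq_or_ne j i with rfl | hj <;> simp [*]
  · rfl
  · rfl

theorem IsFlow.passChain_eq_augment {C : PairwiseEnergy G} {m : Messages G} {T : Chain G}
    (hC : C.IsCanonical) (h : C.IsFlow m) (hT : C.IsAugmenting m T) :
    C.passChain m T = m.augment T (C.bottleneck m T) := by
  obtain ⟨hs, ht, -⟩ := (C.isAugmenting_iff m T).1 hT
  rw [residualSource, sub_pos] at hs
  rw [residualSink, sub_pos] at ht
  have hne := h.first_ne_last hC hT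
  have hfirst := h.unary_first_eq_zero hC hT
  have hlast := h.unary_last_eq_zero hC hT
  set m₂ := (m.raiseUnary T.first true (C.bottleneck m T)).push T.walk.darts (C.bottleneck m T)
    with hm₂
  have hunary : m₂.unary T.last = m.unary T.last := by
    funext a
    simp [hm₂, hne.symm]
  have hforward : C.sendUnary (C.dampingFirst m T) m T.first =
      m.raiseUnary T.first true (C.bottleneck m T) :=
    sendUnary_eq_raiseUnary hfirst (h.unary_eq_zero hfirst) (h.unary_nonneg _ _) hs hT.le
  have hbackward : C.sendUnary (C.dampingLast m T) m₂ T.last =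
      m₂.raiseUnary T.last false (C.bottleneck m T) := by
    rw [dampingLast, ← hunary]
    apply sendUnary_eq_raiseUnary hlast
    · exact hunary ▸ h.unary_eq_zero hlast
    · exact hunary ▸ h.unary_nonneg _ _
    · exact hunary ▸ ht
    · exact hT.le
  rw [passChain, hforward, h.foldl_sendDart_forward hC hT.le le_rfl, ← hm₂, hbackward]
  exact h.foldl_sendDart_backward hC hT.le le_rfl

end PairwiseEnergy

/-! ### Shortest augmenting paths -/

namespace PairwiseEnergy

/-- The vertices that can be reached from the source through a residual edge and at most `k`
residual darts. -/
def reach {V : Type*} {G : SimpleGraph V} (C : PairwiseEnergy G) (m : Messages G) (k : ℕ) : Set V :=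
  {v | ∃ (u : V) (p : G.Walk u v), 0 < C.residualSource m u ∧ (∀ d ∈ p.darts, 0 < C.residual m d) ∧
    p.length ≤ k}

/-- An augmenting path with the fewest possible edges. -/
def IsShortestAugmenting {V : Type*} {G : SimpleGraph V} (C : PairwiseEnergy G) (m : Messages G)
    (T : Chain G) : Prop :=
  C.IsAugmenting m T ∧ ∀ T', C.IsAugmenting m T' → T.walk.length ≤ T'.walk.length

section Reach

variable {V : Type*} {G : SimpleGraph V} {C : PairwiseEnergy G} {m : Messages G}

theorem reach_mono : Monotone (C.reach m) := fun _ _ hkl _ ⟨u, p, hu, hp, hpk⟩ =>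
  ⟨u, p, hu, hp, hpk.trans hkl⟩

theorem snd_mem_reach_succ {k : ℕ} {d : G.Dart} (hd : 0 < C.residual m d)
    (hk : d.fst ∈ C.reach m k) : d.snd ∈ C.reach m (k + 1) := by
  obtain ⟨u, p, hu, hp, hpk⟩ := hk
  refine ⟨u, p.concat d.adj, hu, fun e he => ?_, by simpa using hpk⟩
  rw [SimpleGraph.Walk.darts_concat, List.concat_eq_append, List.mem_append,
    List.mem_singleton] at he
  rcases he with he | rfl
  exacts [hp e he, hd]

theorem exists_isAugmenting_of_walk {u v : V} (p : G.Walk u v)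
    (hu : 0 < C.residualSource m u) (hv : 0 < C.residualSink m v)
    (hp : ∀ d ∈ p.darts, 0 < C.residual m d) :
    ∃ T, C.IsAugmenting m T ∧ T.walk.length ≤ p.length := by
  classical
  exact ⟨⟨u, v, p.bypass, p.bypass_isPath⟩, (C.isAugmenting_iff m _).2
    ⟨hu, hv, fun d hd => hp d (p.darts_bypass_subset_darts hd)⟩, p.length_bypass_le_length⟩

/-- Every dart of a shortest augmenting path leads from one level of `C.reach m` to the next. -/
theorem IsShortestAugmenting.exists_level [Fintype V] {T : Chain G}
    (hT : C.IsShortestAugmenting m T) {d : G.Dart} (hd : d ∈ T.walk.darts) :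
    ∃ i < Fintype.card V, d.fst ∈ C.reach m i ∧ ∀ k, d.snd ∈ C.reach m k → i + 1 ≤ k := by
  obtain ⟨hs, ht, hr⟩ := (C.isAugmenting_iff m T).1 hT.1
  obtain ⟨q, r, hqr⟩ := (SimpleGraph.Walk.isSubwalk_toWalk_adj_iff_mem_darts T.walk).2 hd
  have hlength : T.walk.length = q.length + 1 + r.length := by
    simp [hqr]
  have hcard := T.isPath.length_lt
  simp only [hqr, SimpleGraph.Walk.darts_append, List.mem_append] at hr
  refine ⟨q.length, by omega, ⟨_, q, hs, fun e he => hr e (.inl (.inl he)), le_rfl⟩, ?_⟩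
  rintro k ⟨u, p, hu, hp, hpk⟩
  obtain ⟨T', hT', hle⟩ := exists_isAugmenting_of_walk (p.append r) hu ht fun e he => by
    rw [SimpleGraph.Walk.darts_append, List.mem_append] at he
    exact he.elim (hp e) fun he => hr e (.inr he)
  have hmin := hT.2 T' hT'
  rw [SimpleGraph.Walk.length_append] at hle
  omega

theorem residualSource_pos_of_augment [DecidableEq V] {T : Chain G} (hT : C.IsAugmenting m T)
    {i : V} (hi : 0 < C.residualSource (m.augment T (C.bottleneck m T)) i) :
    0 < C.residualSource m i := by
  have hf : 0 < C.bottleneck m T := hT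
  rw [residualSource_augment] at hi
  grind

theorem residualSink_pos_of_augment [DecidableEq V] {T : Chain G} (hT : C.IsAugmenting m T)
    {i : V} (hi : 0 < C.residualSink (m.augment T (C.bottleneck m T)) i) :
    0 < C.residualSink m i := by
  have hf : 0 < C.bottleneck m T := hT
  rw [residualSink_augment] at hi
  grind

end Reach

variable {V : Type*} [Fintype V] [DecidableEq V] {G : SimpleGraph V} [DecidableRel G.Adj]

section ShortestAugmentation

variable {C : PairwiseEnergy G} {m : Messages G} {T : Chain G}

theorem IsFlow.residual_pos_of_augment (h : C.IsFlow m) (hT : C.IsAugmenting m T) {d : G.Dart}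
    (hd : 0 < C.residual (m.augment T (C.bottleneck m T)) d) :
    0 < C.residual m d ∨ d.symm ∈ T.walk.darts := by
  have hf : 0 < C.bottleneck m T := hT
  rw [h.residual_augment hT.le le_rfl] at hd
  grind

/-- The residual darts created by the augmentation run from a level to the preceding one. -/
theorem IsFlow.reach_augment_subset (h : C.IsFlow m) (hT : C.IsShortestAugmenting m T) (k : ℕ) :
    C.reach (m.augment T (C.bottleneck m T)) k ⊆ C.reach m k := by
  suffices hwalk : ∀ {u v : V} (p : G.Walk u v) (j : ℕ), u ∈ C.reach m j →
      (∀ d ∈ p.darts, 0 < C.residual (m.augment T (C.bottleneck m T)) d) →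
      v ∈ C.reach m (j + p.length) by
    rintro v ⟨u, p, hu, hp, hpk⟩
    have hu₀ : u ∈ C.reach m 0 :=
      ⟨u, .nil, residualSource_pos_of_augment hT.1 hu, by simp, le_rfl⟩
    exact reach_mono (by omega) (hwalk p 0 hu₀ hp)
  intro u v p
  induction p with
  | nil => exact fun j hj _ => hj
  | @cons u w v huw p ih =>
    intro j hj hp
    simp only [SimpleGraph.Walk.darts_cons, List.mem_cons, forall_eq_or_imp] at hp
    have hw : w ∈ C.reach m (j + 1) := by
      rcases h.residual_pos_of_augment hT.1 hp.1 with hd | hd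
      · exact snd_mem_reach_succ hd hj
      · obtain ⟨i, -, hi, hlevel⟩ := hT.exists_level hd
        exact reach_mono (by have := hlevel j hj; omega) hi
    rw [SimpleGraph.Walk.length_cons, ← add_assoc, add_right_comm]
    exact ih (j + 1) hw hp.2

/-- The pairs of a level (below the number of vertices) and a vertex reached at it. -/
def levelPairs (C : PairwiseEnergy G) (m : Messages G) : Set (Fin (Fintype.card V) × V) :=
  {x | x.2 ∈ C.reach m x.1}

/-- The residual edges that a shortest augmenting path may use: darts that leave a level set, edges
from the source, and edges to the sink. -/
def liveEdges (C : PairwiseEnergy G) (m : Messages G) : Set (G.Dart ⊕ V ⊕ V) :=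
  {e | Sum.elim
    (fun d => 0 < C.residual m d ∧
      ∃ k < Fintype.card V, d.fst ∈ C.reach m k ∧ d.snd ∉ C.reach m k)
    (Sum.elim (fun i => 0 < C.residualSource m i) fun i => 0 < C.residualSink m i) e}

/-- The termination measure of the shortest-path rule: augmenting along a shortest path shrinks the
level sets, or keeps them and saturates a live edge. -/
noncomputable def progress (C : PairwiseEnergy G) (m : Messages G) : ℕ ×ₗ ℕ :=
  toLex ((C.levelPairs m).ncard, (C.liveEdges m).ncard)

theorem IsFlow.liveEdges_augment_subset (h : C.IsFlow m) (hT : C.IsShortestAugmenting m T)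
    (hlevels : C.levelPairs m ⊆ C.levelPairs (m.augment T (C.bottleneck m T))) :
    C.liveEdges (m.augment T (C.bottleneck m T)) ⊆ C.liveEdges m := by
  rintro (d | i | i) he
  · obtain ⟨hd, k, hk, hfst, hsnd⟩ := he
    have hfst' := h.reach_augment_subset hT k hfst
    have hsnd' : d.snd ∉ C.reach m k := fun hmem => hsnd (hlevels (a := (⟨k, hk⟩, d.snd)) hmem)
    refine ⟨(h.residual_pos_of_augment hT.1 hd).resolve_right fun hd' => ?_, k, hk, hfst', hsnd'⟩
    obtain ⟨i, -, hi, hlevel⟩ := hT.exists_level hd'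
    exact hsnd' (reach_mono (by have := hlevel k hfst'; omega) hi)
  · exact residualSource_pos_of_augment hT.1 he
  · exact residualSink_pos_of_augment hT.1 he

theorem IsFlow.exists_saturated_liveEdge (h : C.IsFlow m) (hT : C.IsShortestAugmenting m T) :
    ∃ e ∈ C.liveEdges m, e ∉ C.liveEdges (m.augment T (C.bottleneck m T)) := by
  obtain ⟨hs, ht, hr⟩ := (C.isAugmenting_iff m T).1 hT.1
  rcases C.bottleneck_eq_residual m T with hb | hb | ⟨d, hd, hb⟩
  · refine ⟨.inr (.inl T.first), hs, fun hpos : 0 < C.residualSource _ _ => hpos.ne' ?_⟩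
    rw [residualSource_augment, if_pos rfl, hb, sub_self]
  · refine ⟨.inr (.inr T.last), ht, fun hpos : 0 < C.residualSink _ _ => hpos.ne' ?_⟩
    rw [residualSink_augment, if_pos rfl, hb, sub_self]
  · obtain ⟨i, hi, hfst, hlevel⟩ := hT.exists_level hd
    refine ⟨.inl d, ⟨hr d hd, i, hi, hfst, fun hsnd => (hlevel i hsnd).not_gt i.lt_succ_self⟩,
      fun hd' => hd'.1.ne' ?_⟩
    rw [h.residual_augment hT.1.le le_rfl, if_pos hd,
      if_neg (symm_notMem_darts_of_isTrail T.isPath.isTrail hd), hb, sub_self, add_zero]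

theorem IsFlow.progress_augment_lt (h : C.IsFlow m) (hT : C.IsShortestAugmenting m T) :
    C.progress (m.augment T (C.bottleneck m T)) < C.progress m := by
  have hlevels : C.levelPairs (m.augment T (C.bottleneck m T)) ⊆ C.levelPairs m :=
    fun x hx => h.reach_augment_subset hT x.1 hx
  rw [progress, progress, Prod.Lex.toLex_lt_toLex]
  rcases hlevels.eq_or_ssubset with heq | hssubset
  · obtain ⟨e, he, he'⟩ := h.exists_saturated_liveEdge hT
    exact .inr ⟨congrArg Set.ncard heq, Set.ncard_lt_ncard
      ((h.liveEdges_augment_subset hT heq.ge).ssubset_of_mem_notMem he he')⟩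
  · exact .inl (Set.ncard_lt_ncard hssubset)

end ShortestAugmentation

end PairwiseEnergy

/-! ### Termination of Phase 1 -/

theorem exists_pos_forall_ratCast_mem_zmultiples {ι K : Type*} [Finite ι] [Field K] [LinearOrder K]
    [IsStrictOrderedRing K] (q : ι → ℚ) :
    ∃ δ : K, 0 < δ ∧ ∀ i, (q i : K) ∈ AddSubgroup.zmultiples δ := by
  have := Fintype.ofFinite ι
  have hpos : 0 < ∏ i, (q i).den := Finset.prod_pos fun i _ => (q i).den_pos
  refine ⟨((∏ i, (q i).den : ℕ) : K)⁻¹, by positivity, fun i => ?_⟩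
  obtain ⟨k, hk⟩ := Finset.dvd_prod_of_mem (fun j => (q j).den) (Finset.mem_univ i)
  have hk₀ : (k : K) ≠ 0 := Nat.cast_ne_zero.2 (by rintro rfl; simp [hk] at hpos)
  refine ⟨(q i).num * k, ?_⟩
  rw [hk, Rat.cast_def]
  push_cast [zsmul_eq_mul]
  field_simp

theorem le_of_mem_zmultiples {α : Type*} [AddCommGroup α] [LinearOrder α] [IsOrderedAddMonoid α]
    {a b : α} (ha : 0 < a) (hb : 0 < b) (hab : b ∈ AddSubgroup.zmultiples a) : a ≤ b := by
  obtain ⟨n, rfl⟩ := hab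
  have hn : 0 < n := (zsmul_lt_zsmul_iff_left ha).1 (by simpa using hb)
  simpa using zsmul_le_zsmul_left ha.le (Int.add_one_le_iff.2 hn)

/-- The differences of the entries of the messages lie in `H`: the encoded flow is integral. -/
structure Messages.ValuedIn {V : Type*} {G : SimpleGraph V} (m : Messages G) (H : AddSubgroup ℝ) :
    Prop where
  flow_mem : ∀ d, m.flow d ∈ H
  unary_mem : ∀ i a, m.unary i a ∈ H

theorem Messages.ValuedIn.augment {V : Type*} [DecidableEq V] {G : SimpleGraph V} {m : Messages G}
    {H : AddSubgroup ℝ} (hm : m.ValuedIn H) (T : Chain G) {f : ℝ} (hf : f ∈ H) :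
    (m.augment T f).ValuedIn H := by
  have hite (P : Prop) [Decidable P] : (if P then f else 0) ∈ H := by
    split_ifs
    exacts [hf, H.zero_mem]
  constructor
  · intro d
    rw [flow_augment]
    exact H.sub_mem (H.add_mem (hm.flow_mem d) (hite _)) (hite _)
  · intro i a
    rw [unary_augment]
    exact H.add_mem (H.add_mem (hm.unary_mem i a) (hite _)) (hite _)

theorem Messages.sum_unary_augment {V : Type*} [Fintype V] [DecidableEq V] {G : SimpleGraph V}
    (m : Messages G) (T : Chain G) (f : ℝ) :
    ∑ i, (m.augment T f).unary i true = ∑ i, m.unary i true + f := by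
  simp [unary_augment, Finset.sum_add_distrib]

namespace PairwiseEnergy

/-- All potentials lie in the subgroup `H`. -/
structure ValuedIn {V : Type*} {G : SimpleGraph V} (C : PairwiseEnergy G) (H : AddSubgroup ℝ) :
    Prop where
  unary_mem : ∀ i a, C.unary i a ∈ H
  pair_mem : ∀ d a b, C.pair d a b ∈ H

section

variable {V : Type*} {G : SimpleGraph V} {C : PairwiseEnergy G} {m : Messages G}

theorem IsRational.exists_valuedIn_zmultiples [Finite V] (hC : C.IsRational) :
    ∃ δ : ℝ, 0 < δ ∧ C.ValuedIn (AddSubgroup.zmultiples δ) := by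
  classical
  have := Fintype.ofFinite V
  choose q hq using hC.1
  choose r hr using hC.2
  obtain ⟨δ, hδ, h⟩ := exists_pos_forall_ratCast_mem_zmultiples (K := ℝ)
    (Sum.elim (fun x : V × Bool => q x.1 x.2) fun x : G.Dart × Bool × Bool => r x.1 x.2.1 x.2.2)
  refine ⟨δ, hδ, fun i a => ?_, fun d a b => ?_⟩
  · rw [hq]
    exact h (.inl (i, a))
  · rw [hr]
    exact h (.inr (d, a, b))

theorem exists_isShortestAugmenting (h : ∃ T, C.IsAugmenting m T) :
    ∃ T, C.IsShortestAugmenting m T := by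
  obtain ⟨T, hT, hmin⟩ := (measure fun T : Chain G => T.walk.length).wf.has_min
    {T | C.IsAugmenting m T} h
  exact ⟨T, hT, fun T' hT' => not_lt.1 (hmin T' hT')⟩

theorem exists_isScheduler_isShortestPath (C : PairwiseEnergy G) :
    ∃ S : ℕ → Messages G → Option (Chain G), C.IsScheduler S ∧ C.IsShortestPath S := by
  have hchoice (m : Messages G) : ∃ o : Option (Chain G),
      (∀ T, o = some T → C.IsShortestAugmenting m T) ∧
        (o = none → ∀ T, ¬ C.IsAugmenting m T) := by
    by_cases h : ∃ T, C.IsAugmenting m T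
    · obtain ⟨T, hT⟩ := exists_isShortestAugmenting h
      exact ⟨some T, fun T' hT' => Option.some.inj hT' ▸ hT, fun hT' => by simp at hT'⟩
    · exact ⟨none, fun T hT => by simp at hT, fun _ => not_exists.1 h⟩
  choose o hsome hnone using hchoice
  exact ⟨fun _ m => o m, fun _ m => ⟨fun T hT => (hsome m T hT).1, hnone m⟩,
    fun _ m T hT => (hsome m T hT).2⟩

end

variable {V : Type*} [Fintype V] [DecidableEq V] {G : SimpleGraph V} [DecidableRel G.Adj]
variable {C : PairwiseEnergy G} {m : Messages G} {T : Chain G}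
variable {S : ℕ → Messages G → Option (Chain G)}

theorem IsFlow.bottleneck_mem {H : AddSubgroup ℝ} (h : C.IsFlow m) (hC : C.ValuedIn H)
    (hm : m.ValuedIn H) (T : Chain G) : C.bottleneck m T ∈ H := by
  rcases C.bottleneck_eq_residual m T with hb | hb | ⟨d, -, hb⟩ <;> rw [hb]
  · exact H.sub_mem (hC.unary_mem _ _) (hm.unary_mem _ _)
  · exact H.sub_mem (hC.unary_mem _ _) (hm.unary_mem _ _)
  · rw [h.residual_eq]
    exact H.sub_mem (hC.pair_mem _ _ _) (hm.flow_mem d)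

theorem apmp_succ_of_some {t : ℕ} (ht : C.apmp S t = (m, false)) (hT : S t m = some T) :
    C.apmp S (t + 1) = (C.passChain m T, false) := by
  simp only [apmp, ht, hT]

theorem apmp_succ_of_none {t : ℕ} (ht : C.apmp S t = (m, false)) (hT : S t m = none) :
    C.apmp S (t + 1) = (m, true) := by
  simp only [apmp, ht, hT]

theorem apmp_succ_of_true {t : ℕ} (ht : C.apmp S t = (m, true)) :
    C.apmp S (t + 1) = (C.strictMP m, true) := by
  simp only [apmp, ht]

theorem phase1_induction {P : Messages G → Prop} (hS : C.IsScheduler S)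
    (zero : P (zeroMessages G))
    (passChain : ∀ m T, P m → C.IsAugmenting m T → P (C.passChain m T)) {t : ℕ} {m : Messages G}
    (ht : C.apmp S t = (m, false)) : P m := by
  induction t generalizing m with
  | zero =>
    rw [apmp, Prod.mk.injEq] at ht
    exact ht.1 ▸ zero
  | succ t ih =>
    rcases h : C.apmp S t with ⟨m', _ | _⟩
    · rcases hT : S t m' with _ | T
      · simp [apmp_succ_of_none h hT] at ht
      · rw [apmp_succ_of_some h hT, Prod.mk.injEq] at ht
        exact ht.1 ▸ passChain m' T (ih h) ((hS t m').1 T hT)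
    · simp [apmp_succ_of_true h] at ht

theorem isFlow_of_apmp (hC : C.IsCanonical) (hS : C.IsScheduler S) {t : ℕ}
    (ht : C.apmp S t = (m, false)) : C.IsFlow m :=
  phase1_induction hS (isFlow_zeroMessages hC)
    (fun _ _ h hT => h.passChain_eq_augment hC hT ▸ h.augment hT.le le_rfl) ht

theorem valuedIn_of_apmp (hC : C.IsCanonical) (hS : C.IsScheduler S) {H : AddSubgroup ℝ}
    (hH : C.ValuedIn H) {t : ℕ} (ht : C.apmp S t = (m, false)) : m.ValuedIn H := by
  refine (phase1_induction (P := fun m => C.IsFlow m ∧ m.ValuedIn H) hS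
    ⟨isFlow_zeroMessages hC, ?_⟩ (fun m T ⟨h, hm⟩ hT => ?_) ht).2
  · exact ⟨fun d => by simp [Messages.flow, zeroMessages], fun _ _ => H.zero_mem⟩
  · rw [h.passChain_eq_augment hC hT]
    exact ⟨h.augment hT.le le_rfl, hm.augment T (h.bottleneck_mem hH hm T)⟩

theorem exists_apmp_succ_eq_augment_of_not_terminates (hC : C.IsCanonical) (hS : C.IsScheduler S)
    (h : ¬ C.Phase1Terminates S) (t : ℕ) :
    ∃ m T, C.apmp S t = (m, false) ∧ S t m = some T ∧ C.IsAugmenting m T ∧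
      C.apmp S (t + 1) = (m.augment T (C.bottleneck m T), false) := by
  have hflag (t : ℕ) : (C.apmp S t).2 = false := Bool.eq_false_iff.2 (not_exists.1 h t)
  rcases hm : C.apmp S t with ⟨m, b⟩
  obtain rfl : b = false := by simpa [hm] using hflag t
  rcases hT : S t m with _ | T
  · simpa [apmp_succ_of_none hm hT] using hflag (t + 1)
  · have hA := (hS t m).1 T hT
    refine ⟨m, T, rfl, hT, hA, ?_⟩
    rw [apmp_succ_of_some hm hT, (isFlow_of_apmp hC hS hm).passChain_eq_augment hC hA]

theorem phase1Terminates_of_isShortestPath (hC : C.IsCanonical) (hS : C.IsScheduler S)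
    (hshort : C.IsShortestPath S) : C.Phase1Terminates S := by
  by_contra hnot
  refine not_strictAnti_of_wellFoundedLT (fun t => C.progress (C.apmp S t).1)
    (strictAnti_nat_of_succ_lt fun t => ?_)
  obtain ⟨m, T, ht, hT, hA, hsucc⟩ :=
    exists_apmp_succ_eq_augment_of_not_terminates hC hS hnot t
  rw [ht, hsucc]
  exact (isFlow_of_apmp hC hS ht).progress_augment_lt ⟨hA, hshort t m T hT⟩

theorem phase1Terminates_of_isRational (hC : C.IsCanonical) (hS : C.IsScheduler S)
    (hrat : C.IsRational) : C.Phase1Terminates S := by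
  by_contra hnot
  obtain ⟨δ, hδ, hH⟩ := hrat.exists_valuedIn_zmultiples
  have hgrowth (t : ℕ) : t • δ ≤ ∑ i, (C.apmp S t).1.unary i true := by
    induction t with
    | zero => simp [apmp, zeroMessages]
    | succ t ih =>
      obtain ⟨m, T, ht, -, hA, hsucc⟩ :=
        exists_apmp_succ_eq_augment_of_not_terminates hC hS hnot t
      have hmem := (isFlow_of_apmp hC hS ht).bottleneck_mem hH (valuedIn_of_apmp hC hS hH ht) T
      rw [ht] at ih
      rw [hsucc, Messages.sum_unary_augment, succ_nsmul]
      exact add_le_add ih (le_of_mem_zmultiples hδ hA hmem)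
  obtain ⟨t, ht⟩ := exists_lt_nsmul hδ (∑ i, C.unary i true)
  obtain ⟨m, -, hm, -⟩ := exists_apmp_succ_eq_augment_of_not_terminates hC hS hnot t
  have hbound : ∑ i, m.unary i true ≤ ∑ i, C.unary i true :=
    Finset.sum_le_sum fun i _ => (isFlow_of_apmp hC hS hm).unary_le i true
  have hlt := ht.trans_le (hgrowth t)
  rw [hm] at hlt
  exact (hlt.trans_le hbound).false

end PairwiseEnergy

/-! ### Strict max-product without augmenting paths -/

theorem finite_closure_inter_Iic {M : Type*} [AddCommMonoid M] [PartialOrder M]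
    [IsOrderedCancelAddMonoid M] [Archimedean M] {s : Set M} (hs : s.Finite)
    (hnonneg : ∀ a ∈ s, 0 ≤ a) (b : M) :
    ((AddSubmonoid.closure s : Set M) ∩ Set.Iic b).Finite := by
  induction s, hs using Set.Finite.induction_on with
  | empty => exact (Set.finite_singleton 0).subset fun x hx => by simpa using hx.1
  | @insert a s _ _ ih =>
    obtain ⟨ha, hs⟩ := Set.forall_mem_insert.1 hnonneg
    rcases ha.eq_or_lt with rfl | hpos
    · rw [AddSubmonoid.closure_insert_zero]
      exact ih hs
    obtain ⟨N, hN⟩ := Archimedean.arch b hpos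
    refine ((Set.finite_Iic N).image2 (fun n y => n • a + y) (ih hs)).subset ?_
    rintro x ⟨hx, hxb⟩
    rw [SetLike.mem_coe, Set.insert_eq, AddSubmonoid.closure_union, AddSubmonoid.mem_sup] at hx
    obtain ⟨z, hz, y, hy, rfl⟩ := hx
    obtain ⟨n, rfl⟩ := AddSubmonoid.mem_closure_singleton.1 hz
    have hy₀ : 0 ≤ y := (AddSubmonoid.closure_le (S := AddSubmonoid.nonneg M)).2 hs hy
    have hnb : n • a ≤ b := (le_add_of_nonneg_right hy₀).trans hxb
    exact ⟨n, (nsmul_left_strictMono hpos).le_iff_le.1 (hnb.trans hN), y,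
      ⟨hy, (le_add_of_nonneg_left (nsmul_nonneg ha n)).trans hxb⟩, rfl⟩

theorem exists_isFixedPt_iterate {α : Type*} [PartialOrder α] {F : α → α} (hF : Monotone F) {x : α}
    (hx : x ≤ F x) (hfin : (Set.range fun n => F^[n] x).Finite) :
    ∃ n, Function.IsFixedPt F (F^[n] x) := by
  have hmono : Monotone fun n => F^[n] x := hF.monotone_iterate_of_le_map hx
  obtain ⟨i, j, hij, heq⟩ := hfin.exists_lt_map_eq_of_forall_mem (Set.mem_range_self ·)
  refine ⟨i, le_antisymm ?_ ?_⟩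
  · rw [← Function.iterate_succ_apply' F, heq]
    exact hmono hij
  · rw [← Function.iterate_succ_apply' F]
    exact hmono i.le_succ

namespace PairwiseEnergy

/-- Magnitudes of the messages to the factors and of the messages to the variables. -/
abbrev Magnitudes {V : Type*} (G : SimpleGraph V) : Type _ := (G.Dart → ℝ) × (G.Dart → ℝ)

section Magnitudes

variable {V : Type*} [Fintype V] [DecidableEq V] {G : SimpleGraph V} [DecidableRel G.Adj]
variable {ρ : V → ℝ} {R : G.Dart → ℝ} {x : Magnitudes G}

/-- The effect of Strict MP on magnitudes when all messages into a variable have the same sign: `ρ`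
is the evidence at the variables and `R` bounds the messages to the variables. -/
noncomputable def magnitudeStep (ρ : V → ℝ) (R : G.Dart → ℝ) (x : Magnitudes G) : Magnitudes G :=
  (fun d => ρ d.fst + ∑ e : G.Dart with e.snd = d.fst ∧ e ≠ d.symm, x.2 e,
    fun d => min (x.1 d) (R d))

/-- Upper bounds on the magnitudes that arise from zero. -/
noncomputable def magnitudeBound (ρ : V → ℝ) (R : G.Dart → ℝ) : Magnitudes G :=
  (fun d => ρ d.fst + ∑ e : G.Dart with e.snd = d.fst ∧ e ≠ d.symm, R e, R)

/-- The evidence at a variable together with the magnitudes of all messages to it. -/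
noncomputable def totalMagnitude (ρ : V → ℝ) (x : Magnitudes G) (i : V) : ℝ :=
  ρ i + ∑ e : G.Dart with e.snd = i, x.2 e

theorem monotone_magnitudeStep (ρ : V → ℝ) (R : G.Dart → ℝ) : Monotone (magnitudeStep ρ R) :=
  fun _ _ ⟨h₁, h₂⟩ => ⟨fun _ => add_le_add_right (Finset.sum_le_sum fun e _ => h₂ e) _,
    fun d => min_le_min_right _ (h₁ d)⟩

theorem magnitudeStep_zero_nonneg (hρ : 0 ≤ ρ) (hR : 0 ≤ R) : 0 ≤ magnitudeStep ρ R 0 :=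
  ⟨fun d => add_nonneg (hρ d.fst) (Finset.sum_nonneg fun _ _ => le_rfl),
    fun d => le_min le_rfl (hR d)⟩

theorem magnitudeStep_mem_Icc (hρ : 0 ≤ ρ) (hR : 0 ≤ R)
    (hx : x ∈ Set.Icc 0 (magnitudeBound ρ R)) :
    magnitudeStep ρ R x ∈ Set.Icc 0 (magnitudeBound ρ R) :=
  ⟨(magnitudeStep_zero_nonneg hρ hR).trans (monotone_magnitudeStep ρ R hx.1),
    (monotone_magnitudeStep ρ R hx.2).trans ⟨le_rfl, fun _ => min_le_right _ _⟩⟩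

theorem iterate_magnitudeStep_mem_Icc (hρ : 0 ≤ ρ) (hR : 0 ≤ R) (n : ℕ) :
    (magnitudeStep ρ R)^[n] 0 ∈ Set.Icc 0 (magnitudeBound ρ R) := by
  induction n with
  | zero =>
    exact ⟨le_rfl, fun d => add_nonneg (hρ d.fst) (Finset.sum_nonneg fun e _ => hR e), hR⟩
  | succ n ih =>
    rw [Function.iterate_succ_apply']
    exact magnitudeStep_mem_Icc hρ hR ih

theorem iterate_magnitudeStep_mem_closure (ρ : V → ℝ) (R : G.Dart → ℝ) (n : ℕ) (d : G.Dart) :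
    ((magnitudeStep ρ R)^[n] 0).1 d ∈ AddSubmonoid.closure (Set.range ρ ∪ Set.range R) ∧
      ((magnitudeStep ρ R)^[n] 0).2 d ∈ AddSubmonoid.closure (Set.range ρ ∪ Set.range R) := by
  have hρmem (i : V) : ρ i ∈ AddSubmonoid.closure (Set.range ρ ∪ Set.range R) :=
    AddSubmonoid.subset_closure (.inl ⟨i, rfl⟩)
  have hRmem (d : G.Dart) : R d ∈ AddSubmonoid.closure (Set.range ρ ∪ Set.range R) :=
    AddSubmonoid.subset_closure (.inr ⟨d, rfl⟩)
  induction n generalizing d with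
  | zero => exact ⟨zero_mem _, zero_mem _⟩
  | succ n ih =>
    rw [Function.iterate_succ_apply']
    exact ⟨add_mem (hρmem _) (sum_mem fun e _ => (ih e).2),
      min_rec' (· ∈ AddSubmonoid.closure (Set.range ρ ∪ Set.range R)) (ih d).1 (hRmem d)⟩

/-- All magnitudes are sums of entries of `ρ` and `R`, and only finitely many such sums are below
the bound. -/
theorem exists_isFixedPt_iterate_magnitudeStep (hρ : 0 ≤ ρ) (hR : 0 ≤ R) :
    ∃ n, Function.IsFixedPt (magnitudeStep ρ R) ((magnitudeStep ρ R)^[n] 0) := by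
  refine exists_isFixedPt_iterate (monotone_magnitudeStep ρ R)
    (magnitudeStep_zero_nonneg hρ hR) ?_
  have hsums := finite_closure_inter_Iic ((Set.finite_range ρ).union (Set.finite_range R)) (by
    rintro a (⟨i, rfl⟩ | ⟨d, rfl⟩)
    exacts [hρ i, hR d])
  refine ((Set.Finite.pi' fun d => hsums ((magnitudeBound ρ R).1 d)).prod
    (Set.Finite.pi' fun d => hsums ((magnitudeBound ρ R).2 d))).subset ?_
  rintro _ ⟨n, rfl⟩
  have hmem := iterate_magnitudeStep_mem_closure ρ R n
  have hle := (iterate_magnitudeStep_mem_Icc hρ hR n).2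
  exact ⟨fun d => ⟨(hmem d).1, hle.1 d⟩, fun d => ⟨(hmem d).2, hle.2 d⟩⟩

theorem totalMagnitude_fst (ρ : V → ℝ) (R : G.Dart → ℝ) (x : Magnitudes G) (d : G.Dart) :
    totalMagnitude ρ x d.fst = (magnitudeStep ρ R x).1 d + x.2 d.symm := by
  rw [totalMagnitude, sum_dart_snd_eq_add, magnitudeStep]
  ring

theorem totalMagnitude_pos (hx : 0 ≤ x) {i : V} (hi : 0 < ρ i) : 0 < totalMagnitude ρ x i :=
  add_pos_of_pos_of_nonneg hi (Finset.sum_nonneg fun e _ => hx.2 e)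

theorem totalMagnitude_snd_pos (hx : 0 ≤ x) (hfix : Function.IsFixedPt (magnitudeStep ρ R) x)
    {d : G.Dart} (hd : 0 < R d) (hfst : 0 < totalMagnitude ρ x d.fst) :
    0 < totalMagnitude ρ x d.snd := by
  have hmin (d : G.Dart) : x.2 d = min (x.1 d) (R d) := (congrFun (congrArg Prod.snd hfix) d).symm
  have hsnd : totalMagnitude ρ x d.snd = x.1 d.symm + x.2 d :=
    (totalMagnitude_fst ρ R x d.symm).trans (by rw [hfix.eq, SimpleGraph.Dart.symm_symm])
  rw [totalMagnitude_fst ρ R, hfix.eq] at hfst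
  rw [hsnd]
  have hnonneg : 0 ≤ x.1 d := hx.1 d
  rcases hnonneg.eq_or_lt with hzero | hpos
  · have hback : 0 < x.2 d.symm := by rwa [← hzero, zero_add] at hfst
    have hle : x.2 d.symm ≤ x.1 d.symm := (hmin d.symm).trans_le (min_le_left _ _)
    exact add_pos_of_pos_of_nonneg (hback.trans_le hle) (hx.2 d)
  · exact add_pos_of_nonneg_of_pos (hx.1 d.symm) ((lt_min hpos hd).trans_eq (hmin d).symm)

end Magnitudes

section Sides

variable {V : Type*} {G : SimpleGraph V} {C : PairwiseEnergy G} {m : Messages G}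

/-- `i` can be reached from the source in the residual graph. -/
def OnSourceSide (C : PairwiseEnergy G) (m : Messages G) (i : V) : Prop := ∃ k, i ∈ C.reach m k

/-- The sink can be reached from `i` in the residual graph. -/
def OnSinkSide (C : PairwiseEnergy G) (m : Messages G) (i : V) : Prop :=
  ∃ (w : V) (p : G.Walk i w), 0 < C.residualSink m w ∧ ∀ d ∈ p.darts, 0 < C.residual m d

theorem onSourceSide_of_residualSource_pos {i : V} (h : 0 < C.residualSource m i) :
    C.OnSourceSide m i := ⟨0, i, .nil, h, by simp, le_rfl⟩

theorem onSinkSide_of_residualSink_pos {i : V} (h : 0 < C.residualSink m i) :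
    C.OnSinkSide m i := ⟨i, .nil, h, by simp⟩

theorem OnSourceSide.snd {d : G.Dart} (h : C.OnSourceSide m d.fst) (hd : 0 < C.residual m d) :
    C.OnSourceSide m d.snd :=
  let ⟨k, hk⟩ := h
  ⟨k + 1, snd_mem_reach_succ hd hk⟩

theorem OnSinkSide.fst {d : G.Dart} (h : C.OnSinkSide m d.snd) (hd : 0 < C.residual m d) :
    C.OnSinkSide m d.fst := by
  obtain ⟨w, p, hw, hp⟩ := h
  refine ⟨w, .cons d.adj p, hw, ?_⟩
  rw [SimpleGraph.Walk.darts_cons, List.forall_mem_cons]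
  exact ⟨hd, hp⟩

theorem OnSinkSide.not_onSourceSide (hno : ∀ T, ¬ C.IsAugmenting m T) {i : V}
    (h : C.OnSinkSide m i) : ¬ C.OnSourceSide m i := by
  rintro ⟨k, u, p, hu, hp, -⟩
  obtain ⟨w, q, hw, hq⟩ := h
  obtain ⟨T, hT, -⟩ := exists_isAugmenting_of_walk (p.append q) hu hw fun e he => by
    rw [SimpleGraph.Walk.darts_append, List.mem_append] at he
    exact he.elim (hp e) (hq e)
  exact hno T hT

open Classical in
/-- The sign of the Phase 2 messages into a vertex: `1` on the source side, `-1` on the sink side,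
and `0` elsewhere. -/
noncomputable def side (C : PairwiseEnergy G) (m : Messages G) (i : V) : ℝ :=
  if C.OnSourceSide m i then 1 else if C.OnSinkSide m i then -1 else 0

open Classical in
/-- The residual capacity of a dart in the direction in which Phase 2 changes the flow. -/
noncomputable def slack (C : PairwiseEnergy G) (m : Messages G) (d : G.Dart) : ℝ :=
  if C.OnSourceSide m d.fst then C.residual m d else
    if C.OnSinkSide m d.fst then C.residual m d.symm else 0

/-- The evidence at a variable which the flow does not use. -/
noncomputable def surplus (C : PairwiseEnergy G) (m : Messages G) (i : V) : ℝ :=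
  C.residualSource m i - C.residualSink m i

theorem OnSourceSide.side_eq {i : V} (h : C.OnSourceSide m i) : C.side m i = 1 := if_pos h

theorem OnSinkSide.side_eq (hno : ∀ T, ¬ C.IsAugmenting m T) {i : V} (h : C.OnSinkSide m i) :
    C.side m i = -1 := by
  rw [side, if_neg (h.not_onSourceSide hno), if_pos h]

theorem side_fst_eq_side_snd (hno : ∀ T, ¬ C.IsAugmenting m T) {d : G.Dart}
    (hd : 0 < C.slack m d) : C.side m d.fst = C.side m d.snd := by
  rw [slack] at hd
  split_ifs at hd with hsource hsink
  · rw [hsource.side_eq, (hsource.snd hd).side_eq]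
  · have hsnd : C.OnSinkSide m d.snd := OnSinkSide.fst (d := d.symm) hsink hd
    rw [hsink.side_eq hno, hsnd.side_eq hno]
  · exact absurd hd (lt_irrefl 0)

theorem side_fst_mul_eq (hno : ∀ T, ¬ C.IsAugmenting m T) {d : G.Dart} {x : ℝ} (hx : 0 ≤ x)
    (hxd : x ≤ C.slack m d) : C.side m d.fst * x = C.side m d.snd * x := by
  rcases hx.eq_or_lt with rfl | hx
  · simp only [mul_zero]
  · rw [side_fst_eq_side_snd hno (hx.trans_le hxd)]

/-- The state of Phase 2 with magnitudes `x`: the differences of the messages are those of the flow,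
shifted by the magnitudes in the direction of the side. -/
noncomputable def phase2Messages (C : PairwiseEnergy G) (m : Messages G) (x : Magnitudes G) :
    Messages G where
  unary := C.unary
  toFactor d := msgOfDiff (m.flow d + C.side m d.fst * x.1 d)
  toVar d := msgOfDiff (m.flow d + C.side m d.fst * x.2 d)

theorem flow_phase2Messages (C : PairwiseEnergy G) (m : Messages G) (x : Magnitudes G)
    (d : G.Dart) : (C.phase2Messages m x).flow d = m.flow d + C.side m d.fst * x.2 d :=
  msgOfDiff_sub _

theorem IsCanonical.unaryUpdate_eq (hC : C.IsCanonical) : C.unaryUpdate = C.unary := by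
  funext i
  obtain ⟨hfalse, htrue, h | h⟩ := hC.2 i
  · exact normalizeMsg_eq_self (by rw [h, min_eq_left htrue])
  · exact normalizeMsg_eq_self (by rw [h, min_eq_right hfalse])

end Sides

section Phase2

variable {V : Type*} [Fintype V] [DecidableEq V] {G : SimpleGraph V} [DecidableRel G.Adj]
variable {C : PairwiseEnergy G} {m : Messages G}

namespace IsFlow

theorem slack_nonneg (h : C.IsFlow m) : 0 ≤ C.slack m := fun d => by
  rw [slack]
  split_ifs
  exacts [h.residual_nonneg _, h.residual_nonneg _, le_rfl]

theorem residualSource_nonneg (h : C.IsFlow m) (i : V) : 0 ≤ C.residualSource m i :=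
  sub_nonneg.2 (h.unary_le i true)

theorem residualSink_nonneg (h : C.IsFlow m) (i : V) : 0 ≤ C.residualSink m i :=
  sub_nonneg.2 (h.unary_le i false)

theorem residualSource_eq_zero_or (hC : C.IsCanonical) (h : C.IsFlow m) (i : V) :
    C.residualSource m i = 0 ∨ C.residualSink m i = 0 := by
  rw [residualSource, residualSink]
  rcases (hC.2 i).2.2 with hi | hi
  · exact .inr (by rw [h.unary_eq_zero hi, hi, sub_self])
  · exact .inl (by rw [h.unary_eq_zero hi, hi, sub_self])

theorem surplus_eq (hC : C.IsCanonical) (h : C.IsFlow m) (hno : ∀ T, ¬ C.IsAugmenting m T)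
    (i : V) : C.surplus m i = C.side m i * |C.surplus m i| := by
  have hs := h.residualSource_nonneg i
  have ht := h.residualSink_nonneg i
  rw [surplus]
  rcases h.residualSource_eq_zero_or hC i with hi | hi
  · rcases ht.eq_or_lt with ht₀ | hpos
    · simp [hi, ← ht₀]
    · simp [hi, (onSinkSide_of_residualSink_pos hpos).side_eq hno, abs_of_pos hpos]
  · rcases hs.eq_or_lt with hs₀ | hpos
    · simp [hi, ← hs₀]
    · simp [hi, (onSourceSide_of_residualSource_pos hpos).side_eq, abs_of_pos hpos]

theorem clamp_eq (h : C.IsFlow m) (d : G.Dart) {x : ℝ} (hx : 0 ≤ x) :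
    max (-C.pair d.symm false true) (min (m.flow d + C.side m d.fst * x) (C.pair d false true)) =
      m.flow d + C.side m d.fst * min x (C.slack m d) := by
  have hupper := h.flow_le d
  have hlower := h.neg_pair_le_flow d
  rw [side, slack]
  split_ifs
  · rw [h.residual_eq]
    grind
  · rw [h.residual_eq, h.flow_symm]
    grind
  · rw [zero_mul, zero_mul, add_zero, min_eq_left hupper, max_eq_right hlower]

theorem strictMP_eq (hC : C.IsCanonical) (h : C.IsFlow m) :
    C.strictMP m = C.phase2Messages m 0 := by
  refine Messages.ext hC.unaryUpdate_eq (funext fun d => ?_) (funext fun d => ?_)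
  · simp [strictMP, phase2Messages, toFactorUpdate_eq, h.excess_eq, h.flow_symm]
  · have hclamp := h.clamp_eq d le_rfl
    rw [min_eq_left (show 0 ≤ C.slack m d from h.slack_nonneg d), mul_zero, add_zero] at hclamp
    simp [strictMP, phase2Messages, C.toVarUpdate_eq hC (h.toFactor_eq d), hclamp]

theorem excess_phase2Messages (hC : C.IsCanonical) (h : C.IsFlow m)
    (hno : ∀ T, ¬ C.IsAugmenting m T) {x : Magnitudes G}
    (hx : ∀ d, 0 ≤ x.2 d ∧ x.2 d ≤ C.slack m d) (i : V) :
    (C.phase2Messages m x).excess i =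
      C.side m i * totalMagnitude |C.surplus m| x i := by
  have hside : ∑ e : G.Dart with e.snd = i, C.side m e.fst * x.2 e =
      C.side m i * ∑ e : G.Dart with e.snd = i, x.2 e := by
    rw [Finset.mul_sum]
    refine Finset.sum_congr rfl fun e he => ?_
    rw [side_fst_mul_eq hno (hx e).1 (hx e).2, (Finset.mem_filter.1 he).2]
  have hexcess := h.excess_eq i
  rw [Messages.excess] at hexcess
  rw [totalMagnitude, Pi.abs_apply, mul_add, ← h.surplus_eq hC hno, Messages.excess]
  simp only [flow_phase2Messages, Finset.sum_add_distrib, hside, surplus, residualSource,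
    residualSink]
  simp only [phase2Messages]
  linarith

theorem strictMP_phase2Messages (hC : C.IsCanonical) (h : C.IsFlow m)
    (hno : ∀ T, ¬ C.IsAugmenting m T) {x : Magnitudes G}
    (hx : ∀ d, 0 ≤ x.1 d ∧ 0 ≤ x.2 d ∧ x.2 d ≤ C.slack m d) :
    C.strictMP (C.phase2Messages m x) =
      C.phase2Messages m (magnitudeStep |C.surplus m| (C.slack m) x) := by
  refine Messages.ext hC.unaryUpdate_eq (funext fun d => ?_) (funext fun d => ?_)
  · change C.toFactorUpdate (C.phase2Messages m x) d = msgOfDiff (m.flow d + C.side m d.fst *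
      (|C.surplus m d.fst| + ∑ e : G.Dart with e.snd = d.fst ∧ e ≠ d.symm, x.2 e))
    have hside : C.side m d.symm.fst * x.2 d.symm = C.side m d.fst * x.2 d.symm :=
      side_fst_mul_eq hno (hx d.symm).2.1 (hx d.symm).2.2
    rw [toFactorUpdate_eq, h.excess_phase2Messages hC hno fun d => (hx d).2,
      totalMagnitude, Pi.abs_apply, sum_dart_snd_eq_add, flow_phase2Messages, h.flow_symm, hside]
    congr 1
    ring
  · change C.toVarUpdate (C.phase2Messages m x) d =
      msgOfDiff (m.flow d + C.side m d.fst * min (x.1 d) (C.slack m d))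
    rw [C.toVarUpdate_eq hC (z := m.flow d + C.side m d.fst * x.1 d) rfl, h.clamp_eq d (hx d).1]

theorem iterate_strictMP (hC : C.IsCanonical) (h : C.IsFlow m) (hno : ∀ T, ¬ C.IsAugmenting m T)
    (n : ℕ) : C.strictMP^[n + 1] m =
      C.phase2Messages m ((magnitudeStep |C.surplus m| (C.slack m))^[n] 0) := by
  induction n with
  | zero => exact h.strictMP_eq hC
  | succ n ih =>
    obtain ⟨hnonneg, hle⟩ := iterate_magnitudeStep_mem_Icc (abs_nonneg (C.surplus m))
      h.slack_nonneg n
    rw [Function.iterate_succ_apply', ih, h.strictMP_phase2Messages hC hno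
      fun d => ⟨hnonneg.1 d, hnonneg.2 d, hle.2 d⟩,
      ← Function.iterate_succ_apply' (magnitudeStep _ _)]

end IsFlow

end Phase2

end PairwiseEnergy

/-! ### Decoding and minimum cuts -/

namespace PairwiseEnergy

section Cut

variable {V : Type*} [Fintype V] {G : SimpleGraph V} [DecidableRel G.Adj]

theorem sum_dart_symm {M : Type*} [AddCommMonoid M] (g : G.Dart → M) :
    ∑ d : G.Dart, g d.symm = ∑ d, g d :=
  Equiv.sum_comp (Function.Involutive.toPerm _ SimpleGraph.Dart.symm_involutive) g

theorem sum_dart_snd_eq_true {M : Type*} [DecidableEq V] [AddCommMonoid M] (g : G.Dart → M)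
    (x : V → Bool) : ∑ d : G.Dart with x d.snd = true, g d =
      ∑ i with x i = true, ∑ e : G.Dart with e.snd = i, g e := by
  rw [← Finset.sum_fiberwise_of_maps_to (t := {i | x i = true})
    (g := fun d : G.Dart => d.snd) fun d hd => by simpa using hd]
  refine Finset.sum_congr rfl fun i hi => Finset.sum_congr ?_ fun _ _ => rfl
  have hi' := (Finset.mem_filter.1 hi).2
  ext d
  grind

/-- The darts from label `0` to label `1`. -/
def cutDarts (G : SimpleGraph V) [DecidableRel G.Adj] (x : V → Bool) : Finset G.Dart :=
  {d | x d.fst = false ∧ x d.snd = true}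

theorem sum_cutDarts_of_antisymm {M : Type*} [DecidableEq V] [AddCommGroup M] {φ : G.Dart → M}
    (hφ : ∀ d, φ d.symm = -φ d) (x : V → Bool) :
    ∑ d ∈ cutDarts G x, φ d = ∑ i with x i = true, ∑ e : G.Dart with e.snd = i, φ e := by
  have hinner : ∑ d : G.Dart with x d.snd = true ∧ x d.fst = true, φ d = 0 :=
    Finset.sum_involution (fun d _ => d.symm) (fun d _ => by rw [hφ, add_neg_cancel])
      (fun d _ _ => d.symm_ne) (fun d hd => by simpa [and_comm] using hd)
      fun d _ => d.symm_symm
  rw [← sum_dart_snd_eq_true,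
    ← Finset.sum_filter_add_sum_filter_not {d : G.Dart | x d.snd = true}
      (fun d : G.Dart => x d.fst = true),
    Finset.filter_filter, Finset.filter_filter, hinner, zero_add]
  refine Finset.sum_congr (Finset.filter_congr fun d _ => ?_) fun _ _ => rfl
  rw [Bool.not_eq_true, and_comm]

variable {C : PairwiseEnergy G} {m : Messages G}

theorem IsCanonical.energy_eq (hC : C.IsCanonical) (x : V → Bool) :
    C.energy x = ∑ i, C.unary i (x i) + ∑ d ∈ cutDarts G x, C.pair d false true := by
  have hpair (d : G.Dart) : C.pair d (x d.fst) (x d.snd) =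
      (if x d.fst = false ∧ x d.snd = true then C.pair d false true else 0) +
        if x d.symm.fst = false ∧ x d.symm.snd = true then C.pair d.symm false true else 0 := by
    obtain ⟨hff, htt, -, -⟩ := hC.1 d
    cases hfst : x d.fst <;> cases hsnd : x d.snd <;>
      simp [hff, htt, C.pair_true_false, hfst, hsnd]
  rw [energy, Finset.sum_congr rfl fun d _ => hpair d, Finset.sum_add_distrib,
    sum_dart_symm fun d : G.Dart =>
      if x d.fst = false ∧ x d.snd = true then C.pair d false true else 0,
    cutDarts, Finset.sum_filter]
  ring

/-- The residual capacity of the cut that separates the vertices labelled `0`, on the side of the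
source, from those labelled `1`. -/
noncomputable def residualCut (C : PairwiseEnergy G) (m : Messages G) (x : V → Bool) : ℝ :=
  ∑ i, (C.unary i (x i) - m.unary i (x i)) + ∑ d ∈ cutDarts G x, C.residual m d

variable [DecidableEq V]

namespace IsFlow

/-- The constant is the value of the flow, so that minimum cuts are the minimizers. -/
theorem energy_eq (hC : C.IsCanonical) (h : C.IsFlow m) (x : V → Bool) :
    C.energy x = ∑ i, m.unary i false + C.residualCut m x := by
  have hflow : ∑ d ∈ cutDarts G x, m.flow d =
      ∑ i, (m.unary i false - m.unary i (x i)) := by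
    rw [sum_cutDarts_of_antisymm h.flow_symm, Finset.sum_filter]
    refine Finset.sum_congr rfl fun i _ => ?_
    have hexcess := h.excess_eq i
    rw [Messages.excess] at hexcess
    cases x i
    · simp
    · simp only [if_true]
      linarith
  rw [Finset.sum_sub_distrib] at hflow
  simp only [hC.energy_eq, residualCut, h.residual_eq, Finset.sum_sub_distrib, hflow]
  ring

theorem residualCut_nonneg (h : C.IsFlow m) (x : V → Bool) : 0 ≤ C.residualCut m x :=
  add_nonneg (Finset.sum_nonneg fun i _ => sub_nonneg.2 (h.unary_le i _))
    (Finset.sum_nonneg fun d _ => h.residual_nonneg d)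

theorem isMinimizer_of_residualCut_eq_zero (hC : C.IsCanonical) (h : C.IsFlow m) {x : V → Bool}
    (hx : C.residualCut m x = 0) : C.IsMinimizer x := fun y => by
  rw [h.energy_eq hC, h.energy_eq hC, hx]
  exact add_le_add_right (h.residualCut_nonneg y) _

end IsFlow

end Cut

section Decoding

variable {V : Type*} [Fintype V] [DecidableEq V] {G : SimpleGraph V} [DecidableRel G.Adj]

theorem belief_sub (E : PairwiseEnergy G) (m : Messages G) (i : V) :
    E.belief m i true - E.belief m i false = E.unary i true - E.unary i false +
      ∑ e : G.Dart with e.snd = i, m.flow e := by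
  simp only [belief, Messages.flow, Finset.sum_sub_distrib]
  ring

theorem exists_isDecoding (E : PairwiseEnergy G) (m : Messages G) : ∃ x, E.IsDecoding m x := by
  classical
  refine ⟨fun i => decide (E.belief m i true < E.belief m i false), fun i a => ?_,
    fun d hfst hsnd _ => by simp only [hfst, hsnd, lt_irrefl]⟩
  by_cases hlt : E.belief m i true < E.belief m i false
  · cases a <;> simp [hlt, hlt.le]
  · cases a <;> simp [hlt, not_lt.1 hlt]

variable {C : PairwiseEnergy G} {m : Messages G} {x : Magnitudes G} {y : V → Bool}

theorem IsDecoding.eq_false (hy : C.IsDecoding m y) {i : V}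
    (hi : 0 < C.belief m i true - C.belief m i false) : y i = false := by
  refine Bool.eq_false_of_not_eq_true fun htrue => ?_
  have hle := hy.1 i false
  rw [htrue] at hle
  linarith

theorem IsDecoding.eq_true (hy : C.IsDecoding m y) {i : V}
    (hi : C.belief m i true - C.belief m i false < 0) : y i = true := by
  refine Bool.eq_true_of_not_eq_false fun hfalse => ?_
  have hle := hy.1 i true
  rw [hfalse] at hle
  linarith

/-- The magnitudes `x` are stationary under Strict MP in Phase 2. -/
structure IsStationary (C : PairwiseEnergy G) (m : Messages G) (x : Magnitudes G) : Prop where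
  nonneg : 0 ≤ x
  isFixedPt : Function.IsFixedPt (magnitudeStep |C.surplus m| (C.slack m)) x

theorem IsStationary.snd_le (hx : C.IsStationary m x) (d : G.Dart) : x.2 d ≤ C.slack m d :=
  (congrFun (congrArg Prod.snd hx.isFixedPt) d).symm.trans_le (min_le_right _ _)

namespace IsFlow

theorem totalMagnitude_pos_of_onSourceSide (hC : C.IsCanonical) (h : C.IsFlow m)
    (hx : C.IsStationary m x) {i : V} (hi : C.OnSourceSide m i) :
    0 < totalMagnitude |C.surplus m| x i := by
  suffices hwalk : ∀ {u v : V} (p : G.Walk u v), (∀ d ∈ p.darts, 0 < C.residual m d) →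
      C.OnSourceSide m u → 0 < totalMagnitude |C.surplus m| x u →
      0 < totalMagnitude |C.surplus m| x v by
    obtain ⟨k, u, p, hu, hp, -⟩ := hi
    refine hwalk p hp (onSourceSide_of_residualSource_pos hu) (totalMagnitude_pos hx.nonneg ?_)
    rw [Pi.abs_apply, abs_pos, surplus, (h.residualSource_eq_zero_or hC u).resolve_left hu.ne',
      sub_zero]
    exact hu.ne'
  intro u v p hp hside hpos
  induction p with
  | nil => exact hpos
  | cons a p ih =>
    rw [SimpleGraph.Walk.darts_cons, List.forall_mem_cons] at hp
    refine ih hp.2 (OnSourceSide.snd hside hp.1)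
      (totalMagnitude_snd_pos hx.nonneg hx.isFixedPt (d := ⟨(_, _), a⟩) ?_ hpos)
    rw [slack, if_pos hside]
    exact hp.1

theorem totalMagnitude_pos_of_onSinkSide (hC : C.IsCanonical) (h : C.IsFlow m)
    (hno : ∀ T, ¬ C.IsAugmenting m T) (hx : C.IsStationary m x) {i : V} (hi : C.OnSinkSide m i) :
    0 < totalMagnitude |C.surplus m| x i := by
  obtain ⟨w, p, hw, hp⟩ := hi
  induction p with
  | nil =>
    refine totalMagnitude_pos hx.nonneg ?_
    rw [Pi.abs_apply, abs_pos, surplus, (h.residualSource_eq_zero_or hC _).resolve_right hw.ne',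
      zero_sub]
    exact neg_ne_zero.2 hw.ne'
  | @cons u v w a p ih =>
    rw [SimpleGraph.Walk.darts_cons, List.forall_mem_cons] at hp
    have hv : C.OnSinkSide m v := ⟨w, p, hw, hp.2⟩
    refine totalMagnitude_snd_pos hx.nonneg hx.isFixedPt (d := ⟨(v, u), a.symm⟩) ?_ (ih hw hp.2)
    rw [slack, if_neg (hv.not_onSourceSide hno), if_pos hv]
    exact hp.1

theorem belief_sub_phase2Messages (hC : C.IsCanonical) (h : C.IsFlow m)
    (hno : ∀ T, ¬ C.IsAugmenting m T) (hx : C.IsStationary m x) (i : V) :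
    C.belief (C.phase2Messages m x) i true - C.belief (C.phase2Messages m x) i false =
      C.side m i * totalMagnitude |C.surplus m| x i :=
  (C.belief_sub _ i).trans
    (h.excess_phase2Messages hC hno (fun d => ⟨hx.nonneg.2 d, hx.snd_le d⟩) i)

section

variable (hC : C.IsCanonical) (h : C.IsFlow m) (hno : ∀ T, ¬ C.IsAugmenting m T)
  (hx : C.IsStationary m x)

include hC h hno hx

theorem eq_false_of_onSourceSide (hy : C.IsDecoding (C.phase2Messages m x) y) {i : V}
    (hi : C.OnSourceSide m i) : y i = false :=
  hy.eq_false <| by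
    rw [h.belief_sub_phase2Messages hC hno hx, hi.side_eq, one_mul]
    exact h.totalMagnitude_pos_of_onSourceSide hC hx hi

theorem eq_true_of_onSinkSide (hy : C.IsDecoding (C.phase2Messages m x) y) {i : V}
    (hi : C.OnSinkSide m i) : y i = true :=
  hy.eq_true <| by
    rw [h.belief_sub_phase2Messages hC hno hx, hi.side_eq hno, neg_one_mul, neg_lt_zero]
    exact h.totalMagnitude_pos_of_onSinkSide hC hno hx hi

theorem belief_false_eq_belief_true {i : V} (hsource : ¬ C.OnSourceSide m i)
    (hsink : ¬ C.OnSinkSide m i) :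
    C.belief (C.phase2Messages m x) i false = C.belief (C.phase2Messages m x) i true := by
  have hsub := h.belief_sub_phase2Messages hC hno hx i
  rw [side, if_neg hsource, if_neg hsink, zero_mul] at hsub
  exact (sub_eq_zero.1 hsub).symm

theorem residual_eq_zero_of_mem_cutDarts (hy : C.IsDecoding (C.phase2Messages m x) y)
    {d : G.Dart} (hd : d ∈ cutDarts G y) : C.residual m d = 0 := by
  obtain ⟨hfst, hsnd⟩ : y d.fst = false ∧ y d.snd = true := by simpa [cutDarts] using hd
  refine ((h.residual_nonneg d).eq_or_lt.resolve_right fun hpos => ?_).symm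
  have hsource {i : V} (hi : y i = true) : ¬ C.OnSourceSide m i := fun hside => by
    simp [h.eq_false_of_onSourceSide hC hno hx hy hside] at hi
  have hsink {i : V} (hi : y i = false) : ¬ C.OnSinkSide m i := fun hside => by
    simp [h.eq_true_of_onSinkSide hC hno hx hy hside] at hi
  have hgap : C.pair d false false + C.pair d true true <
      C.pair d false true + C.pair d true false := by
    have hlower := h.neg_pair_le_flow d
    rw [h.residual_eq] at hpos
    rw [(hC.1 d).1, (hC.1 d).2.1, C.pair_true_false]
    linarith
  have heq := hy.2 d
    (h.belief_false_eq_belief_true hC hno hx (fun hside => hsource hsnd (hside.snd hpos))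
      (hsink hfst))
    (h.belief_false_eq_belief_true hC hno hx (hsource hsnd)
      fun hside => hsink hfst (hside.fst hpos)) hgap
  simp [hfst, hsnd] at heq

theorem residualCut_eq_zero_of_isDecoding (hy : C.IsDecoding (C.phase2Messages m x) y) :
    C.residualCut m y = 0 := by
  rw [residualCut, Finset.sum_eq_zero fun i _ => ?_, Finset.sum_eq_zero fun d hd =>
    h.residual_eq_zero_of_mem_cutDarts hC hno hx hy hd, add_zero]
  refine ((sub_nonneg.2 (h.unary_le i (y i))).eq_or_lt.resolve_right fun hpos => ?_).symm
  cases hyi : y i <;> rw [hyi] at hpos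
  · have hsink := onSinkSide_of_residualSink_pos hpos
    simp [h.eq_true_of_onSinkSide hC hno hx hy hsink] at hyi
  · have hsource := onSourceSide_of_residualSource_pos hpos
    simp [h.eq_false_of_onSourceSide hC hno hx hy hsource] at hyi

theorem isOptimalFixedPoint_phase2Messages : C.IsOptimalFixedPoint (C.phase2Messages m x) := by
  refine ⟨?_, C.exists_isDecoding _, fun y hy =>
    h.isMinimizer_of_residualCut_eq_zero hC (h.residualCut_eq_zero_of_isDecoding hC hno hx hy)⟩
  rw [IsMPFixedPoint, h.strictMP_phase2Messages hC hno
    fun d => ⟨hx.nonneg.1 d, hx.nonneg.2 d, hx.snd_le d⟩, hx.isFixedPt.eq]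

end

theorem exists_isOptimalFixedPoint_iterate_strictMP (hC : C.IsCanonical) (h : C.IsFlow m)
    (hno : ∀ T, ¬ C.IsAugmenting m T) : ∃ n, C.IsOptimalFixedPoint (C.strictMP^[n] m) := by
  have hρ := abs_nonneg (C.surplus m)
  obtain ⟨n, hfix⟩ := exists_isFixedPt_iterate_magnitudeStep hρ h.slack_nonneg
  refine ⟨n + 1, ?_⟩
  rw [h.iterate_strictMP hC hno]
  exact h.isOptimalFixedPoint_phase2Messages hC hno
    ⟨(iterate_magnitudeStep_mem_Icc hρ h.slack_nonneg n).1, hfix⟩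

end IsFlow

end Decoding

end PairwiseEnergy

namespace PairwiseEnergy

section Run

variable {V : Type*} [Fintype V] [DecidableEq V] {G : SimpleGraph V} [DecidableRel G.Adj]
variable {C : PairwiseEnergy G} {m : Messages G} {S : ℕ → Messages G → Option (Chain G)}

theorem exists_isFlow_of_phase1Terminates (hC : C.IsCanonical) (hS : C.IsScheduler S)
    (hT : C.Phase1Terminates S) :
    ∃ t m, C.apmp S t = (m, true) ∧ C.IsFlow m ∧ ∀ T, ¬ C.IsAugmenting m T := by
  obtain ⟨t, ht⟩ := hT
  induction t with
  | zero => exact absurd ht Bool.false_ne_true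
  | succ t ih =>
    obtain ⟨m, b, hm⟩ : ∃ m b, C.apmp S t = (m, b) := ⟨_, _, rfl⟩
    cases b with
    | true => exact ih (by rw [hm])
    | false =>
      rcases hT : S t m with _ | T
      · exact ⟨t + 1, m, apmp_succ_of_none hm hT, isFlow_of_apmp hC hS hm, (hS t m).2 hT⟩
      · simp [apmp_succ_of_some hm hT] at ht

theorem apmp_add_of_true {t : ℕ} (ht : C.apmp S t = (m, true)) (n : ℕ) :
    C.apmp S (t + n) = (C.strictMP^[n] m, true) := by
  induction n with
  | zero => exact ht
  | succ n ih => rw [← add_assoc, apmp_succ_of_true ih, Function.iterate_succ_apply']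

theorem exists_apmp_eq_isOptimalFixedPoint (hC : C.IsCanonical) (hS : C.IsScheduler S)
    (hT : C.Phase1Terminates S) :
    ∃ m K, (∀ k ≥ K, C.apmp S k = (m, true)) ∧ C.IsOptimalFixedPoint m := by
  obtain ⟨t, m, ht, h, hno⟩ := exists_isFlow_of_phase1Terminates hC hS hT
  obtain ⟨n, hn⟩ := h.exists_isOptimalFixedPoint_iterate_strictMP hC hno
  refine ⟨_, t + n, fun k hk => ?_, hn⟩
  obtain ⟨j, rfl⟩ := Nat.exists_eq_add_of_le hk
  rw [add_assoc, apmp_add_of_true ht, add_comm n j, Function.iterate_add_apply,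
    Function.iterate_fixed hn.1]

end Run

/-! ### Canonical forms -/

section CanonicalForm

variable {V : Type*} {G : SimpleGraph V}

/-- Half of the preference of the pairwise potential for the label `0` at the start of the dart;
charged to the label `1` there, it makes the pairwise potential symmetric in the two labels. -/
noncomputable def shift (E : PairwiseEnergy G) (d : G.Dart) : ℝ :=
  (E.pair d true true - E.pair d false false - E.pair d false true + E.pair d true false) / 2

/-- The messages of `E` that correspond to the messages `m` of its canonical form. -/
noncomputable def unshiftMessages (E : PairwiseEnergy G) (m : Messages G) : Messages G where
  unary := E.unaryUpdate
  toFactor d := msgOfDiff (m.toFactor d true - m.toFactor d false - E.shift d)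
  toVar d := msgOfDiff (m.flow d + E.shift d.symm)

theorem flow_unshiftMessages (E : PairwiseEnergy G) (m : Messages G) (d : G.Dart) :
    (E.unshiftMessages m).flow d = m.flow d + E.shift d.symm :=
  msgOfDiff_sub _

variable [Fintype V] [DecidableRel G.Adj]

theorem IsReparametrization.isMinimizer {C E : PairwiseEnergy G} (h : C.IsReparametrization E)
    {x : V → Bool} (hx : C.IsMinimizer x) : E.IsMinimizer x := by
  obtain ⟨c, hc⟩ := h
  intro y
  rw [hc, hc]
  exact add_le_add_left (hx y) c

variable [DecidableEq V]

/-- The energy obtained from `E` by moving the unary parts of the pairwise potentials to the unary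
potentials. -/
noncomputable def canonicalForm (E : PairwiseEnergy G) : PairwiseEnergy G where
  unary i := normalizeMsg fun a =>
    E.unary i a + if a = true then ∑ e : G.Dart with e.snd = i, E.shift e.symm else 0
  pair d a b := if a = b then 0 else
    (E.pair d false true + E.pair d true false - E.pair d false false - E.pair d true true) / 2
  pair_symm d a b := by
    simp only [E.pair_symm d, eq_comm (a := b)]
    split_ifs <;> ring

theorem pair_eq_canonicalForm (E : PairwiseEnergy G) (d : G.Dart) (a b : Bool) :
    E.pair d a b = E.canonicalForm.pair d a b + (if a = true then E.shift d else 0) +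
      (if b = true then E.shift d.symm else 0) + E.pair d false false := by
  cases a <;> cases b <;> simp [canonicalForm, shift, E.pair_symm d] <;> ring

theorem unary_eq_canonicalForm (E : PairwiseEnergy G) (i : V) (a : Bool) :
    E.unary i a = E.canonicalForm.unary i a + (E.unary i false - E.canonicalForm.unary i false) -
      if a = true then ∑ e : G.Dart with e.snd = i, E.shift e.symm else 0 := by
  cases a <;> simp [canonicalForm, normalizeMsg]

theorem isCanonical_canonicalForm {E : PairwiseEnergy G} (hE : E.IsSubmodular) :
    E.canonicalForm.IsCanonical := by
  refine ⟨fun d => ?_, fun i => ?_⟩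
  · have hgap := hE d
    simp only [canonicalForm, reduceCtorEq, ↓reduceIte, true_and, and_self]
    linarith
  · have hmin : min (E.canonicalForm.unary i false) (E.canonicalForm.unary i true) = 0 :=
      min_normalizeMsg fun a =>
        E.unary i a + if a = true then ∑ e : G.Dart with e.snd = i, E.shift e.symm else 0
    rcases min_choice (E.canonicalForm.unary i false) (E.canonicalForm.unary i true) with h | h
    · exact ⟨hmin.ge.trans (min_le_left _ _), hmin.ge.trans (min_le_right _ _), .inl (h ▸ hmin)⟩
    · exact ⟨hmin.ge.trans (min_le_left _ _), hmin.ge.trans (min_le_right _ _), .inr (h ▸ hmin)⟩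

theorem isReparametrization_canonicalForm (E : PairwiseEnergy G) :
    E.canonicalForm.IsReparametrization E := by
  refine ⟨∑ i, (E.unary i false - E.canonicalForm.unary i false) +
    1 / 2 * ∑ d : G.Dart, E.pair d false false, fun x => ?_⟩
  have hsnd := sum_dart_snd_eq_true (fun d : G.Dart => E.shift d.symm) x
  rw [Finset.sum_filter, Finset.sum_filter] at hsnd
  have hfst : ∑ d : G.Dart, (if x d.fst = true then E.shift d else 0) =
      ∑ d : G.Dart, if x d.snd = true then E.shift d.symm else 0 :=
    (sum_dart_symm fun d : G.Dart => if x d.fst = true then E.shift d else 0).symm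
  simp only [energy, pair_eq_canonicalForm E _ (x _), unary_eq_canonicalForm E _ (x _),
    Finset.sum_add_distrib, Finset.sum_sub_distrib, hfst, hsnd]
  ring

theorem belief_sub_unshiftMessages (E : PairwiseEnergy G) (m : Messages G) (i : V) :
    E.belief (E.unshiftMessages m) i true - E.belief (E.unshiftMessages m) i false =
      E.canonicalForm.belief m i true - E.canonicalForm.belief m i false := by
  have hunary := E.unary_eq_canonicalForm i true
  rw [if_pos rfl] at hunary
  simp only [belief_sub, flow_unshiftMessages, Finset.sum_add_distrib]
  linarith

theorem excess_eq_belief_sub {E : PairwiseEnergy G} {m : Messages G}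
    (hm : m.unary = E.unaryUpdate) (i : V) :
    m.excess i = E.belief m i true - E.belief m i false := by
  rw [belief_sub, Messages.excess, hm, unaryUpdate, normalizeMsg_eq_msgOfDiff, msgOfDiff_sub]

theorem toFactorUpdate_unshiftMessages (E : PairwiseEnergy G) {m : Messages G}
    (hm : m.unary = E.canonicalForm.unaryUpdate) (d : G.Dart) :
    E.toFactorUpdate (E.unshiftMessages m) d =
      msgOfDiff (E.canonicalForm.toFactorUpdate m d true -
        E.canonicalForm.toFactorUpdate m d false - E.shift d) := by
  have hexcess : (E.unshiftMessages m).excess d.fst = m.excess d.fst := by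
    rw [excess_eq_belief_sub (E := E) rfl, belief_sub_unshiftMessages, excess_eq_belief_sub hm]
  rw [toFactorUpdate_eq, toFactorUpdate_eq, hexcess, flow_unshiftMessages, msgOfDiff_sub,
    SimpleGraph.Dart.symm_symm, sub_add_eq_sub_sub]

theorem toVarUpdate_unshiftMessages (E : PairwiseEnergy G) (m : Messages G) (d : G.Dart) :
    E.toVarUpdate (E.unshiftMessages m) d =
      msgOfDiff (E.canonicalForm.toVarUpdate m d true -
        E.canonicalForm.toVarUpdate m d false + E.shift d.symm) := by
  have hsum (a b : Bool) : E.pair d a b + (E.unshiftMessages m).toFactor d a =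
      E.canonicalForm.pair d a b + m.toFactor d a +
        ((if b = true then E.shift d.symm else 0) + (E.pair d false false +
          ((E.unshiftMessages m).toFactor d false - m.toFactor d false))) := by
    have hdiff : (E.unshiftMessages m).toFactor d true - (E.unshiftMessages m).toFactor d false =
        m.toFactor d true - m.toFactor d false - E.shift d := msgOfDiff_sub _
    rw [pair_eq_canonicalForm E d a b]
    cases a
    · simp only [Bool.false_eq_true, ↓reduceIte]
      ring
    · simp only [↓reduceIte]
      linarith
  rw [toVarUpdate, toVarUpdate, normalizeMsg_eq_msgOfDiff, normalizeMsg_eq_msgOfDiff,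
    msgOfDiff_sub]
  simp only [hsum, min_add_add_right, ↓reduceIte, Bool.false_eq_true]
  congr 1
  ring

theorem strictMP_unshiftMessages (E : PairwiseEnergy G) {m : Messages G}
    (hm : m.unary = E.canonicalForm.unaryUpdate) :
    E.strictMP (E.unshiftMessages m) = E.unshiftMessages (E.canonicalForm.strictMP m) :=
  Messages.ext rfl (funext (E.toFactorUpdate_unshiftMessages hm))
    (funext (E.toVarUpdate_unshiftMessages m))

theorem gap_canonicalForm (E : PairwiseEnergy G) (d : G.Dart) :
    E.canonicalForm.pair d false true + E.canonicalForm.pair d true false -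
        (E.canonicalForm.pair d false false + E.canonicalForm.pair d true true) =
      E.pair d false true + E.pair d true false - (E.pair d false false + E.pair d true true) := by
  simp only [canonicalForm, reduceCtorEq, ↓reduceIte]
  ring

theorem isDecoding_unshiftMessages_iff (E : PairwiseEnergy G) (m : Messages G) (x : V → Bool) :
    E.IsDecoding (E.unshiftMessages m) x ↔ E.canonicalForm.IsDecoding m x := by
  obtain ⟨c, hbelief⟩ : ∃ c : V → ℝ, ∀ i a, E.belief (E.unshiftMessages m) i a =
      E.canonicalForm.belief m i a + c i := by
    refine ⟨fun i => E.belief (E.unshiftMessages m) i false - E.canonicalForm.belief m i false,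
      fun i a => ?_⟩
    have hsub := E.belief_sub_unshiftMessages m i
    cases a <;> linarith
  have hgap (d : G.Dart) : E.pair d false false + E.pair d true true <
      E.pair d false true + E.pair d true false ↔
      E.canonicalForm.pair d false false + E.canonicalForm.pair d true true <
      E.canonicalForm.pair d false true + E.canonicalForm.pair d true false := by
    rw [← sub_pos, ← gap_canonicalForm, sub_pos]
  refine and_congr (forall₂_congr fun i a => ?_) (forall_congr' fun d => ?_)
  · rw [hbelief, hbelief, add_le_add_iff_right]
  · simp only [hgap, hbelief, add_left_inj]

theorem isOptimalFixedPoint_unshiftMessages {E : PairwiseEnergy G} {m : Messages G}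
    (hm : E.canonicalForm.IsOptimalFixedPoint m) :
    E.IsOptimalFixedPoint (E.unshiftMessages m) := by
  obtain ⟨hfix, -, hmin⟩ := hm
  refine ⟨?_, E.exists_isDecoding _, fun x hx => E.isReparametrization_canonicalForm.isMinimizer
    (hmin x ((E.isDecoding_unshiftMessages_iff m x).1 hx))⟩
  rw [IsMPFixedPoint, E.strictMP_unshiftMessages (congrArg Messages.unary hfix.symm), hfix]

end CanonicalForm

end PairwiseEnergy

theorem mainTheorem2 {V : Type*} [Fintype V] [DecidableEq V] (G : SimpleGraph V)
    [DecidableRel G.Adj] (E : PairwiseEnergy G) (hE : E.IsSubmodular) :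
    (∃ C : PairwiseEnergy G, C.IsCanonical ∧ C.IsReparametrization E) ∧
    (∀ C : PairwiseEnergy G, C.IsCanonical → C.IsReparametrization E →
      (∃ S, C.IsScheduler S ∧ C.IsShortestPath S) ∧
      (∀ S, C.IsScheduler S → C.IsShortestPath S ∨ C.IsRational → C.Phase1Terminates S) ∧
      (∀ S, C.IsScheduler S → C.Phase1Terminates S →
        ∃ (m : Messages G) (K : ℕ), (∀ k ≥ K, C.apmp S k = (m, true)) ∧
          C.IsOptimalFixedPoint m ∧ ∀ x, C.IsDecoding m x → E.IsMinimizer x)) ∧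
    (∃ m : Messages G, E.IsOptimalFixedPoint m) := by
  have hcan := PairwiseEnergy.isCanonical_canonicalForm hE
  refine ⟨⟨_, hcan, E.isReparametrization_canonicalForm⟩, fun C hC hCE =>
    ⟨C.exists_isScheduler_isShortestPath, fun S hS h => ?_, fun S hS hT => ?_⟩, ?_⟩
  · exact h.elim (PairwiseEnergy.phase1Terminates_of_isShortestPath hC hS)
      (PairwiseEnergy.phase1Terminates_of_isRational hC hS)
  · obtain ⟨m, K, hK, hm⟩ := PairwiseEnergy.exists_apmp_eq_isOptimalFixedPoint hC hS hT
    exact ⟨m, K, hK, hm, fun x hx => hCE.isMinimizer (hm.2.2 x hx)⟩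
  · obtain ⟨S, hS, hshort⟩ := E.canonicalForm.exists_isScheduler_isShortestPath
    obtain ⟨m, -, -, hm⟩ := PairwiseEnergy.exists_apmp_eq_isOptimalFixedPoint hcan hS
      (PairwiseEnergy.phase1Terminates_of_isShortestPath hcan hS hshort)
    exact ⟨_, PairwiseEnergy.isOptimalFixedPoint_unshiftMessages hm⟩
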